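/- All graphs are finite and simple. For a clique $\sigma$ of a graph $G$, the link $\mathrm{lk}_G\sigma$ is the subgraph of $G$ induced by the vertices that are adjacent to every vertex of $\sigma$. A graph $G$ with $n$ vertices and $m$ edges is called fascinating if (a) $G$ contains exactly $2(m-n)$ triangles; (b) for every edge $e$ of $G$, the link $\mathrm{lk}_G e$ is a cycle of length at least $4$; (c) for every triangle $t$ of $G$, the link $\mathrm{lk}_G t$ is the graph with two vertices and no edges; (d) for every vertex $v$ of $G$, the link $\mathrm{lk}_G v$ is connected, has at least $6$ vertices, and is a planar graph that can be drawn in the plane without crossings so that every face (including the unbounded one) is bounded by a triangle. The join of two graphs is their disjoint union together with all edges between them. Theorem. There exists a number $n_0$ such that every fascinating graph $G$ with $n\ge n_0$ vertices and $m>\frac14(n^2+2n+17)$ edges is (isomorphic to) a join of two cycles. -/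

import Mathlib

namespace FlagGraph

/-- The vertices of the link of `σ`: those adjacent to every vertex of `σ`. -/
def linkVerts {V : Type*} (G : SimpleGraph V) (σ : Set V) : Set V :=
  {w | ∀ v ∈ σ, G.Adj v w}

/-- The link of `σ` in `G`: the subgraph induced by the common neighbours of `σ`. -/
def link {V : Type*} (G : SimpleGraph V) (σ : Set V) : SimpleGraph (linkVerts G σ) :=
  G.induce (linkVerts G σ)

/-- `G` is a cycle with at least `k` vertices (cycles have at least three vertices). -/
def IsCycleOfLengthAtLeast {V : Type*} (G : SimpleGraph V) (k : ℕ) : Prop :=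
  ∃ l : ℕ, 3 ≤ l ∧ k ≤ l ∧ Nonempty (G ≃g SimpleGraph.cycleGraph l)

/-- The join of two graphs: their disjoint union together with all edges between them. -/
def join {V W : Type*} (G : SimpleGraph V) (H : SimpleGraph W) : SimpleGraph (V ⊕ W) :=
  SimpleGraph.sum G H ⊔ completeBipartiteGraph V W

/-- `G` is isomorphic to a join of two cycles. -/
def IsJoinOfTwoCycles {V : Type*} (G : SimpleGraph V) : Prop :=
  ∃ k l : ℕ, 3 ≤ k ∧ 3 ≤ l ∧
    Nonempty (G ≃g join (SimpleGraph.cycleGraph k) (SimpleGraph.cycleGraph l))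

/-- The Euclidean plane. -/
abbrev Plane : Type := EuclideanSpace ℝ (Fin 2)

/-- A drawing of `G` in the plane without crossings: vertices are distinct points, an edge is a
simple arc between its ends, an arc contains no vertex other than its ends, and distinct arcs meet
only in vertices. -/
structure PlaneDrawing {V : Type*} (G : SimpleGraph V) where
  point : V → Plane
  arc : G.edgeSet → Set Plane
  point_injective : Function.Injective point
  exists_path : ∀ (u v : V) (h : G.Adj u v), ∃ γ : Path (point u) (point v),
    Function.Injective γ ∧ Set.range γ = arc ⟨s(u, v), h⟩
  mem_of_point_mem_arc : ∀ (w : V) (e : G.edgeSet), point w ∈ arc e → w ∈ (e : Sym2 V)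
  arc_inter_arc : ∀ e f : G.edgeSet, e ≠ f → arc e ∩ arc f ⊆ Set.range point

namespace PlaneDrawing

variable {V : Type*} {G : SimpleGraph V}

/-- The point set of the drawing. -/
def support (D : PlaneDrawing G) : Set Plane :=
  Set.range D.point ∪ ⋃ e, D.arc e

/-- The faces of the drawing, among them the unbounded one: the connected components of the
complement of its point set. -/
def IsFace (D : PlaneDrawing G) (F : Set Plane) : Prop :=
  ∃ x ∈ D.supportᶜ, F = connectedComponentIn D.supportᶜ x

/-- The boundary of `F` consists of the three arcs of a triangle of `G`. -/
def IsBoundedByTriangle (D : PlaneDrawing G) (F : Set Plane) : Prop :=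
  ∃ (a b c : V) (hab : G.Adj a b) (hbc : G.Adj b c) (hca : G.Adj c a),
    frontier F = D.arc ⟨s(a, b), hab⟩ ∪ D.arc ⟨s(b, c), hbc⟩ ∪ D.arc ⟨s(c, a), hca⟩

end PlaneDrawing

/-- `G` can be drawn in the plane so that every face, including the unbounded one, is a triangle. -/
def IsPlanarWithTriangularFaces {V : Type*} (G : SimpleGraph V) : Prop :=
  ∃ D : PlaneDrawing G, ∀ F : Set Plane, D.IsFace F → D.IsBoundedByTriangle F

/-- Fascinating graphs. -/
structure IsFascinating {V : Type*} [Fintype V] [DecidableEq V] (G : SimpleGraph V)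
    [DecidableRel G.Adj] : Prop where
  card_triangles : ((G.cliqueFinset 3).card : ℤ) =
    2 * ((G.edgeFinset.card : ℤ) - (Fintype.card V : ℤ))
  edge_link : ∀ u v : V, G.Adj u v → IsCycleOfLengthAtLeast (link G {u, v}) 4
  triangle_link : ∀ t : Finset V, G.IsNClique 3 t →
    (linkVerts G (t : Set V)).ncard = 2 ∧ link G (t : Set V) = ⊥
  vertex_link_connected : ∀ v : V, (link G {v}).Connected
  vertex_link_planar : ∀ v : V, IsPlanarWithTriangularFaces (link G {v})
  vertex_link_card : ∀ v : V, 6 ≤ (linkVerts G {v}).ncard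

end FlagGraph

open Finset

namespace FlagGraph

/-! ### Euler characteristic of connected surfaces -/

section Euler

/-! Link counts. Over `ZMod 2`, a connected closed triangulated surface with d vertices has at least
3d - 6 edges. Applied to all vertex links and summed, this becomes an equality by the prescribed
number of triangles, so every link has exactly 3d - 6 edges (`IsFascinating.isFlagSphereLike`). If
such a link is coloured with two colours, counting its mixed triangles gives at most 2d - 4
bichromatic edges and at least d - 2 monochromatic ones (`eb_cross_le`, `le_eb_inner`).

Structure. Density yields an edge whose neighbourhoods cover all but three vertices, hence a nearly
complete bipartite pattern between two parts A and B with bounded inner degrees (`exists_isSplit`).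
Most vertices turn out to have exactly two neighbours in their own part, and these share its
neighbours in the other part. For such a typical a in A, the set N(a) ∩ B is the link of an edge. A
sharp edge count (`master`) gives typical a and b for which the links N(a) ∩ B and N(b) ∩ A together
miss at most one vertex (`exists_typical_pair`).

Conclusion. If nothing is missed, the colouring bound makes the two cycles completely joined
(`adj_of_partition`). One missed vertex would force 4m ≤ n² + 2n + 17
(`card_edges_le_of_extra_vertex`). -/

theorem card_le_rank_add_one {m n : Type*} [Fintype m] [Fintype n] [DecidableEq n]
    (M : Matrix m n (ZMod 2)) (h : ∀ f : n → ZMod 2, M.mulVec f = 0 → ∀ i j, f i = f j) :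
    Fintype.card n ≤ M.rank + 1 := by
  have h1 := LinearMap.finrank_range_add_finrank_ker M.mulVecLin
  rw [Module.finrank_fintype_fun_eq_card] at h1
  have h2 : LinearMap.ker M.mulVecLin ≤ Submodule.span (ZMod 2) {(fun _ => 1 : n → ZMod 2)} := by
    intro f hf
    have hc := h f (by simpa using hf)
    rw [Submodule.mem_span_singleton]
    rcases isEmpty_or_nonempty n with hn | ⟨⟨i⟩⟩
    · exact ⟨0, Subsingleton.elim _ _⟩
    · exact ⟨f i, funext fun j => by simp [hc i j]⟩
  have h3 := (Submodule.finrank_mono h2).trans (finrank_span_le_card _)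
  simp only [Set.toFinset_singleton, card_singleton] at h3
  unfold Matrix.rank
  omega

variable {W : Type*} [Fintype W] [DecidableEq W] (H : SimpleGraph W) [DecidableRel H.Adj]

/-- The incidence matrix of edges and vertices. -/
def edgeVertexMatrix : Matrix {e // e ∈ H.edgeFinset} W (ZMod 2) :=
  fun e w => if w ∈ e.1 then 1 else 0

/-- The incidence matrix of triangles and edges. -/
def triangleEdgeMatrix :
    Matrix {t // t ∈ H.cliqueFinset 3} {e // e ∈ H.edgeFinset} (ZMod 2) :=
  fun t e => if e.1.toFinset ⊆ t.1 then 1 else 0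

variable {H}

theorem card_edges_subset_triangle {t : Finset W} (ht : t ∈ H.cliqueFinset 3) :
    #{e ∈ H.edgeFinset | e.toFinset ⊆ t} = 3 := by
  rw [SimpleGraph.mem_cliqueFinset_iff, SimpleGraph.is3Clique_iff] at ht
  obtain ⟨a, b, c, hab, hac, hbc, rfl⟩ := ht
  have : ({e ∈ H.edgeFinset | e.toFinset ⊆ {a, b, c}} : Finset (Sym2 W))
      = {s(a, b), s(a, c), s(b, c)} := by
    ext e
    induction e with | _ x y
    have := hab.ne; have := hac.ne; have := hbc.ne
    simp only [mem_filter, SimpleGraph.mem_edgeFinset, SimpleGraph.mem_edgeSet,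
      Sym2.toFinset_mk_eq, insert_subset_iff, singleton_subset_iff, mem_insert, mem_singleton,
      Sym2.eq_iff]
    constructor
    · rintro ⟨h, h1, h2⟩
      have := h.ne
      grind
    · have := hab.symm; have := hac.symm; have := hbc.symm
      rintro ((⟨rfl, rfl⟩ | ⟨rfl, rfl⟩) | (⟨rfl, rfl⟩ | ⟨rfl, rfl⟩) | (⟨rfl, rfl⟩ | ⟨rfl, rfl⟩)) <;>
        simp_all
  rw [this]
  have := hab.ne; have := hac.ne; have := hbc.ne
  rw [card_eq_three]
  refine ⟨_, _, _, ?_, ?_, ?_, rfl⟩ <;> simp only [ne_eq, Sym2.eq_iff] <;> grind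

theorem card_edges_at_vertex_subset_triangle {t : Finset W} (ht : t ∈ H.cliqueFinset 3) (w : W) :
    #{e ∈ H.edgeFinset | w ∈ e ∧ e.toFinset ⊆ t} = if w ∈ t then 2 else 0 := by
  split_ifs with hw
  · rw [SimpleGraph.mem_cliqueFinset_iff] at ht
    obtain ⟨b, c, hab, hac, hbc, rfl⟩ : ∃ b c, H.Adj w b ∧ H.Adj w c ∧ H.Adj b c ∧ t = {w, b, c} := by
      rw [SimpleGraph.is3Clique_iff] at ht
      obtain ⟨x, y, z, hxy, hxz, hyz, rfl⟩ := ht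
      simp only [mem_insert, mem_singleton] at hw
      rcases hw with rfl | rfl | rfl
      · exact ⟨y, z, hxy, hxz, hyz, rfl⟩
      · exact ⟨x, z, hxy.symm, hyz, hxz, by grind⟩
      · exact ⟨x, y, hxz.symm, hyz.symm, hxy, by grind⟩
    have : ({e ∈ H.edgeFinset | w ∈ e ∧ e.toFinset ⊆ {w, b, c}} : Finset (Sym2 W))
        = {s(w, b), s(w, c)} := by
      ext e
      induction e with | _ x y
      simp only [mem_filter, SimpleGraph.mem_edgeFinset, SimpleGraph.mem_edgeSet,
        Sym2.toFinset_mk_eq, insert_subset_iff, singleton_subset_iff, mem_insert, mem_singleton,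
        Sym2.eq_iff, Sym2.mem_iff]
      constructor
      · rintro ⟨h, h1, h2⟩
        have := h.ne
        grind
      · have := hab.symm; have := hac.symm
        rintro ((⟨rfl, rfl⟩ | ⟨rfl, rfl⟩) | (⟨rfl, rfl⟩ | ⟨rfl, rfl⟩)) <;> simp_all
    rw [this, card_pair]
    simp only [ne_eq, Sym2.eq_iff]
    have := hbc.ne
    grind
  · rw [card_eq_zero, filter_eq_empty_iff]
    rintro e - ⟨h1, h2⟩
    exact hw (h2 (by simpa using h1))

/-- This is ∂∂ = 0 mod 2: each vertex of a triangle lies on exactly two of its edges. -/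
theorem triangleEdgeMatrix_mul_edgeVertexMatrix :
    triangleEdgeMatrix H * edgeVertexMatrix H = 0 := by
  ext t w
  have h := card_edges_at_vertex_subset_triangle t.2 w
  rw [card_filter, ← sum_coe_sort] at h
  have h' := congrArg (Nat.cast : ℕ → ZMod 2) h
  rw [Nat.cast_sum] at h'
  simp only [Matrix.mul_apply, triangleEdgeMatrix, edgeVertexMatrix, Matrix.zero_apply]
  rw [show (((if w ∈ t.1 then 2 else 0 : ℕ)) : ZMod 2) = 0 by split_ifs <;> rfl] at h'
  refine Eq.trans (sum_congr rfl fun e _ => ?_) h'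
  by_cases h1 : w ∈ e.1 <;> by_cases h2 : e.1.toFinset ⊆ t.1 <;> simp [h1, h2]

theorem filter_triangles_of_adj {w x : W} (h : H.Adj w x) :
    ({t ∈ H.cliqueFinset 3 | s(w, x).toFinset ⊆ t} : Finset (Finset W)) =
      (H.neighborFinset w ∩ H.neighborFinset x).image (fun y => {w, x, y}) := by
  ext t
  simp only [mem_filter, SimpleGraph.mem_cliqueFinset_iff, Sym2.toFinset_mk_eq, mem_image, mem_inter,
    SimpleGraph.mem_neighborFinset, insert_subset_iff, singleton_subset_iff]
  constructor
  · rintro ⟨ht, hw, hx⟩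
    obtain ⟨y, hy⟩ : ∃ y, t \ {w, x} = {y} := by
      rw [← card_eq_one, card_sdiff_of_subset (by grind), card_pair h.ne, ht.card_eq]
    have hyt : y ∈ t ∧ y ≠ w ∧ y ≠ x := by
      have : y ∈ t \ {w, x} := by simp [hy]
      simpa using this
    refine ⟨y, ⟨ht.isClique hw hyt.1 hyt.2.1.symm, ht.isClique hx hyt.1 hyt.2.2.symm⟩, ?_⟩
    grind
  · rintro ⟨y, ⟨h1, h2⟩, rfl⟩
    exact ⟨SimpleGraph.is3Clique_triple_iff.2 ⟨h, h1, h2⟩, by simp, by simp⟩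

theorem triangle_injOn (w x : W) : Set.InjOn (fun y => ({w, x, y} : Finset W))
    (H.neighborFinset w ∩ H.neighborFinset x : Finset W) := by
  intro y hy z hz hyz
  simp only [coe_inter, SimpleGraph.coe_neighborFinset, Set.mem_inter_iff,
    SimpleGraph.mem_neighborSet] at hy hz
  have := hy.1.ne; have := hy.2.ne
  have : y ∈ ({w, x, z} : Finset W) := by
    rw [← show ({w, x, y} : Finset W) = {w, x, z} from hyz]; simp
  simp only [mem_insert, mem_singleton] at this
  grind

theorem three_mul_card_triangles
    (hedge : ∀ u v, H.Adj u v → #(H.neighborFinset u ∩ H.neighborFinset v) = 2) :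
    3 * #(H.cliqueFinset 3) = 2 * #H.edgeFinset := by
  have h := sum_card_bipartiteAbove_eq_sum_card_bipartiteBelow
    (s := H.cliqueFinset 3) (t := H.edgeFinset) (fun t e => e.toFinset ⊆ t)
  simp only [bipartiteAbove, bipartiteBelow] at h
  rw [sum_const_nat (m := 3) fun t ht => card_edges_subset_triangle ht,
    sum_const_nat (m := 2)] at h
  · omega
  · intro e he
    induction e with | _ w x
    rw [SimpleGraph.mem_edgeFinset, SimpleGraph.mem_edgeSet] at he
    rw [filter_triangles_of_adj he, card_image_of_injOn (triangle_injOn w x),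
      hedge _ _ he]

/-- A 2-cycle takes the same value on the two triangles at an edge, so it descends to a function on
edges. Connected vertex links, in the form `hlink`, make that function constant around each vertex,
and walks in `H` spread the value everywhere. -/
theorem triangle_values_const (hconn : H.Connected)
    (hedge : ∀ u v, H.Adj u v → #(H.neighborFinset u ∩ H.neighborFinset v) = 2)
    (hlink : ∀ v (f : W → ZMod 2), (∀ x y, H.Adj v x → H.Adj v y → H.Adj x y → f x = f y) →
      ∀ x y, H.Adj v x → H.Adj v y → f x = f y)
    (f : {t // t ∈ H.cliqueFinset 3} → ZMod 2)
    (hf : (triangleEdgeMatrix H).transpose.mulVec f = 0) (i j) : f i = f j := by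
  set fe : Finset W → ZMod 2 := fun s => if h : s ∈ H.cliqueFinset 3 then f ⟨s, h⟩ else 0 with hfe
  have key : ∀ w x y z, H.Adj w x → H.Adj w y → H.Adj x y → H.Adj w z → H.Adj x z →
      fe {w, x, y} = fe {w, x, z} := by
    intro w x y z hwx hwy hxy hwz hxz
    by_cases hyz : y = z
    · rw [hyz]
    have h := congrFun hf ⟨s(w, x), by simpa using hwx⟩
    simp only [Matrix.mulVec, dotProduct, Matrix.transpose_apply, triangleEdgeMatrix,
      Pi.zero_apply, ite_mul, one_mul, zero_mul] at h
    have h' : ∑ t ∈ H.cliqueFinset 3, (if s(w, x).toFinset ⊆ t then fe t else 0) = 0 := by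
      rw [← sum_coe_sort]
      refine Eq.trans (sum_congr rfl fun t _ => ?_) h
      have : fe t.1 = f t := dif_pos t.2
      rw [this]
    have hpair : H.neighborFinset w ∩ H.neighborFinset x = {y, z} := by
      symm
      apply eq_of_subset_of_card_le
      · intro u hu
        simp only [mem_insert, mem_singleton] at hu
        rcases hu with rfl | rfl <;> simp [*]
      · rw [hedge _ _ hwx, card_pair hyz]
    rw [← sum_filter, filter_triangles_of_adj hwx, sum_image (triangle_injOn w x), hpair,
      sum_pair hyz] at h'
    have : ∀ p q : ZMod 2, p + q = 0 → p = q := by decide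
    exact this _ _ h'
  have hne : ∀ w x, H.Adj w x → ∃ y, H.Adj w y ∧ H.Adj x y := by
    intro w x h
    have : 0 < #(H.neighborFinset w ∩ H.neighborFinset x) := by rw [hedge _ _ h]; norm_num
    obtain ⟨y, hy⟩ := card_pos.1 this
    exact ⟨y, by simpa using hy⟩
  choose! c hc using hne
  set F : W → W → ZMod 2 := fun w x => fe {w, x, c w x} with hF
  have hFv : ∀ w x y, H.Adj w x → H.Adj w y → H.Adj x y → F w x = fe {w, x, y} :=
    fun w x y h1 h2 h3 => key w x _ _ h1 (hc w x h1).1 (hc w x h1).2 h2 h3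
  have hFs : ∀ w x, H.Adj w x → F w x = F x w := by
    intro w x h
    have hh := hc w x h
    rw [hFv w x _ h hh.1 hh.2, hFv x w _ h.symm hh.2 hh.1, insert_comm]
  have hFc : ∀ w x y, H.Adj w x → H.Adj w y → F w x = F w y := by
    intro w
    refine hlink w (F w) ?_
    intro x y hx hy hxy
    rw [hFv w x y hx hy hxy, hFv w y x hy hx hxy.symm, pair_comm]
  have hdeg : ∀ w x y z, H.Adj w x → H.Adj y z → F w x = F y z := by
    intro w x y z hwx hyz
    obtain ⟨p⟩ := hconn.preconnected w y
    induction p generalizing x with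
    | nil => exact hFc _ _ _ hwx hyz
    | cons h p ih =>
      rw [hFc _ _ _ hwx h, hFs _ _ h]
      exact ih _ h.symm hyz
  have hval : ∀ t : {t // t ∈ H.cliqueFinset 3}, ∃ w x, H.Adj w x ∧ f t = F w x := by
    rintro ⟨t, ht⟩
    have ht' := ht
    rw [SimpleGraph.mem_cliqueFinset_iff, SimpleGraph.is3Clique_iff] at ht'
    obtain ⟨a, b, c, hab, hac, hbc, rfl⟩ := ht'
    refine ⟨a, b, hab, ?_⟩
    rw [hFv a b c hab hac hbc]
    simp only [hfe, dif_pos ht]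
  obtain ⟨w, x, hwx, h1⟩ := hval i
  obtain ⟨y, z, hyz, h2⟩ := hval j
  rw [h1, h2, hdeg _ _ _ _ hwx hyz]

/-- A connected triangulated closed surface has Euler characteristic at most two. -/
theorem three_mul_card_le_card_edges (hconn : H.Connected)
    (hedge : ∀ u v, H.Adj u v → #(H.neighborFinset u ∩ H.neighborFinset v) = 2)
    (hlink : ∀ v (f : W → ZMod 2), (∀ x y, H.Adj v x → H.Adj v y → H.Adj x y → f x = f y) →
      ∀ x y, H.Adj v x → H.Adj v y → f x = f y) :
    3 * Fintype.card W ≤ #H.edgeFinset + 6 := by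
  -- The two ranks add up to at most E and are at least V - 1 and F - 1, so V - E + F ≤ 2; then 3F =
  -- 2E eliminates F.
  have h1 := Matrix.rank_add_rank_le_card_of_mul_eq_zero
    (triangleEdgeMatrix_mul_edgeVertexMatrix (H := H))
  have h2 : Fintype.card W ≤ (edgeVertexMatrix H).rank + 1 := by
    apply card_le_rank_add_one
    intro f hf
    have hadj : ∀ u v, H.Adj u v → f u = f v := by
      intro u v huv
      have h := congrFun hf ⟨s(u, v), by simpa using huv⟩
      simp only [Matrix.mulVec, dotProduct, edgeVertexMatrix, Pi.zero_apply, ite_mul, one_mul,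
        zero_mul, Sym2.mem_iff] at h
      rw [← sum_filter] at h
      have hp : ({a | a = u ∨ a = v} : Finset W) = {u, v} := by ext; simp
      rw [hp, sum_pair huv.ne] at h
      have : ∀ p q : ZMod 2, p + q = 0 → p = q := by decide
      exact this _ _ h
    intro i j
    obtain ⟨p⟩ := hconn.preconnected i j
    induction p with
    | nil => rfl
    | cons h p ih => rw [hadj _ _ h, ih]
  have h3 : Fintype.card {t // t ∈ H.cliqueFinset 3} ≤ (triangleEdgeMatrix H).rank + 1 := by
    rw [← Matrix.rank_transpose]
    exact card_le_rank_add_one _ (triangle_values_const hconn hedge hlink)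
  have h4 := three_mul_card_triangles hedge
  simp only [Fintype.card_coe] at h1 h3
  omega

end Euler

/-! ### Counting adjacent and non-adjacent pairs -/

section Counting

set_option linter.unusedSectionVars false

variable {V : Type*} [Fintype V] [DecidableEq V] (G : SimpleGraph V) [DecidableRel G.Adj]

/-- The number of neighbours of `x` in `S`. -/
def dg (x : V) (S : Finset V) : ℕ := #{y ∈ S | G.Adj x y}

/-- The number of vertices of `S` that are not adjacent to `x`. -/
def nd (x : V) (S : Finset V) : ℕ := #{y ∈ S | ¬ G.Adj x y}

/-- The number of adjacent pairs in `S × T`. -/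
def eb (S T : Finset V) : ℕ := ∑ x ∈ S, dg G x T

/-- The number of non-adjacent pairs in `S × T`. -/
def nb (S T : Finset V) : ℕ := ∑ x ∈ S, nd G x T

variable {G}

theorem dg_add_nd (x : V) (S : Finset V) : dg G x S + nd G x S = #S :=
  card_filter_add_card_filter_not _

theorem eb_add_nb (S T : Finset V) : eb G S T + nb G S T = #S * #T := by
  rw [eb, nb, ← sum_add_distrib, sum_congr rfl fun x _ => dg_add_nd x T, sum_const, smul_eq_mul]

theorem eb_comm (S T : Finset V) : eb G S T = eb G T S := by
  have h := sum_card_bipartiteAbove_eq_sum_card_bipartiteBelow (s := S) (t := T) G.Adj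
  simp only [bipartiteAbove, bipartiteBelow] at h
  simp only [eb, dg, h, G.adj_comm]

theorem nb_comm (S T : Finset V) : nb G S T = nb G T S := by
  have h := sum_card_bipartiteAbove_eq_sum_card_bipartiteBelow (s := S) (t := T)
    (fun x y => ¬ G.Adj x y)
  simp only [bipartiteAbove, bipartiteBelow] at h
  simp only [nb, nd, h, G.adj_comm]

theorem dg_eq_card_inter (x : V) (S : Finset V) : dg G x S = #(G.neighborFinset x ∩ S) := by
  unfold dg; congr 1; ext; simp [and_comm]

theorem dg_univ (x : V) : dg G x univ = G.degree x := by
  rw [dg_eq_card_inter, inter_univ, SimpleGraph.card_neighborFinset_eq_degree]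

theorem dg_union {S T : Finset V} (h : Disjoint S T) (x : V) :
    dg G x (S ∪ T) = dg G x S + dg G x T := by
  unfold dg
  rw [filter_union, card_union_of_disjoint (disjoint_filter_filter h)]

theorem dg_mono {S T : Finset V} (h : S ⊆ T) (x : V) : dg G x S ≤ dg G x T :=
  card_le_card (filter_subset_filter _ h)

theorem nd_mono {S T : Finset V} (h : S ⊆ T) (x : V) : nd G x S ≤ nd G x T :=
  card_le_card (filter_subset_filter _ h)

theorem dg_le_card (x : V) (S : Finset V) : dg G x S ≤ #S := card_filter_le _ _

theorem dg_le_degree (x : V) (S : Finset V) : dg G x S ≤ G.degree x := by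
  rw [← dg_univ]; exact dg_mono (subset_univ _) x

theorem eb_union_left {S T : Finset V} (h : Disjoint S T) (U : Finset V) :
    eb G (S ∪ T) U = eb G S U + eb G T U := sum_union h

theorem eb_union_right {S T : Finset V} (h : Disjoint S T) (U : Finset V) :
    eb G U (S ∪ T) = eb G U S + eb G U T := by
  rw [eb_comm, eb_union_left h, eb_comm S, eb_comm T]

theorem nb_union_left {S T : Finset V} (h : Disjoint S T) (U : Finset V) :
    nb G (S ∪ T) U = nb G S U + nb G T U := sum_union h

theorem nb_union_right {S T : Finset V} (h : Disjoint S T) (U : Finset V) :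
    nb G U (S ∪ T) = nb G U S + nb G U T := by
  rw [nb_comm, nb_union_left h, nb_comm S, nb_comm T]

theorem eb_mono {S S' T T' : Finset V} (hS : S ⊆ S') (hT : T ⊆ T') : eb G S T ≤ eb G S' T' :=
  (sum_le_sum fun x _ => dg_mono hT x).trans (sum_le_sum_of_subset hS)

theorem nb_mono {S S' T T' : Finset V} (hS : S ⊆ S') (hT : T ⊆ T') : nb G S T ≤ nb G S' T' :=
  (sum_le_sum fun x _ => nd_mono hT x).trans (sum_le_sum_of_subset hS)

theorem eb_univ : eb G univ univ = 2 * #G.edgeFinset := by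
  rw [eb, sum_congr rfl fun x _ => dg_univ x, G.sum_degrees_eq_twice_card_edges]

/-- The combinatorial properties of the one-skeleton of a flag manifold used below. -/
structure IsFlagSphereLike (G : SimpleGraph V) [DecidableRel G.Adj] : Prop where
  six_le_degree : ∀ v, 6 ≤ G.degree v
  -- `eb` of a set with itself counts every edge twice, so this is 3d - 6 edges in the link.
  link_count : ∀ v, eb G (G.neighborFinset v) (G.neighborFinset v) + 12 = 6 * G.degree v
  four_le : ∀ u v, G.Adj u v → 4 ≤ #(G.neighborFinset u ∩ G.neighborFinset v)
  triangle : ∀ u v w, G.Adj u v → G.Adj u w → G.Adj v w →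
    #(G.neighborFinset u ∩ G.neighborFinset v ∩ G.neighborFinset w) = 2
  not_adj : ∀ u v w x y, G.Adj u v → G.Adj u w → G.Adj v w → G.Adj u x → G.Adj v x → G.Adj w x →
    G.Adj u y → G.Adj v y → G.Adj w y → ¬ G.Adj x y
  link_conn : ∀ u v, G.Adj u v → ∀ S ⊆ G.neighborFinset u ∩ G.neighborFinset v, S.Nonempty →
    (∀ x ∈ S, ∀ y ∈ G.neighborFinset u ∩ G.neighborFinset v, G.Adj x y → y ∈ S) →
    S = G.neighborFinset u ∩ G.neighborFinset v

theorem mem_linkVerts_singleton {v w : V} : w ∈ linkVerts G {v} ↔ G.Adj v w := by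
  simp [linkVerts]

theorem mem_linkVerts_pair {u v w : V} : w ∈ linkVerts G {u, v} ↔ G.Adj u w ∧ G.Adj v w := by
  simp [linkVerts]

/-- Each triangle is counted once for every ordered pair of its distinct vertices. -/
theorem sum_eb_neighborFinset :
    ∑ v, eb G (G.neighborFinset v) (G.neighborFinset v) = 6 * #(G.cliqueFinset 3) := by
  have h1 : ∀ v, ∀ w ∈ G.neighborFinset v, dg G w (G.neighborFinset v) =
      #{t ∈ G.cliqueFinset 3 | v ∈ t ∧ w ∈ t} := by
    intro v w hw
    rw [SimpleGraph.mem_neighborFinset] at hw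
    have := filter_triangles_of_adj hw
    simp only [Sym2.toFinset_mk_eq, insert_subset_iff, singleton_subset_iff] at this
    rw [this, card_image_of_injOn (triangle_injOn v w), dg_eq_card_inter, inter_comm]
  calc ∑ v, eb G (G.neighborFinset v) (G.neighborFinset v)
      = ∑ v, ∑ w ∈ G.neighborFinset v, ∑ t ∈ G.cliqueFinset 3, if v ∈ t ∧ w ∈ t then 1 else 0 := by
        refine sum_congr rfl fun v _ => sum_congr rfl fun w hw => ?_
        rw [h1 v w hw, card_filter]
    _ = ∑ v, ∑ w, ∑ t ∈ G.cliqueFinset 3, if v ∈ t ∧ w ∈ t ∧ v ≠ w then 1 else 0 := by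
        refine sum_congr rfl fun v _ => ?_
        rw [← sum_subset (subset_univ (G.neighborFinset v))]
        · refine sum_congr rfl fun w hw => sum_congr rfl fun t _ => ?_
          rw [SimpleGraph.mem_neighborFinset] at hw
          simp [hw.ne]
        · intro w _ hw
          refine sum_eq_zero fun t ht => if_neg ?_
          rintro ⟨h1, h2, h3⟩
          rw [SimpleGraph.mem_cliqueFinset_iff] at ht
          exact hw (by simpa using ht.isClique h1 h2 h3)
    _ = ∑ t ∈ G.cliqueFinset 3, ∑ v, ∑ w, if v ∈ t ∧ w ∈ t ∧ v ≠ w then 1 else 0 := by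
        rw [sum_congr rfl fun v _ => sum_comm, sum_comm]
    _ = ∑ t ∈ G.cliqueFinset 3, 6 := by
        refine sum_congr rfl fun t ht => ?_
        rw [SimpleGraph.mem_cliqueFinset_iff] at ht
        have hv : ∀ v, (∑ w, if v ∈ t ∧ w ∈ t ∧ v ≠ w then 1 else 0) = if v ∈ t then 2 else 0 := by
          intro v
          rw [← card_filter]
          split_ifs with hv
          · have : ({w | v ∈ t ∧ w ∈ t ∧ v ≠ w} : Finset V) = t.erase v := by
              ext w; simp [hv, and_comm, eq_comm]
            rw [this, card_erase_of_mem hv, ht.card_eq]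
          · simp [hv]
        rw [sum_congr rfl fun v _ => hv v, ← sum_filter, sum_const, filter_univ_mem, ht.card_eq,
          smul_eq_mul]
    _ = 6 * #(G.cliqueFinset 3) := by rw [sum_const, smul_eq_mul, mul_comm]

theorem IsFascinating.triangle_card (hG : IsFascinating G) {u v w : V} (huv : G.Adj u v)
    (huw : G.Adj u w) (hvw : G.Adj v w) :
    #(G.neighborFinset u ∩ G.neighborFinset v ∩ G.neighborFinset w) = 2 := by
  have h := (hG.triangle_link {u, v, w} (SimpleGraph.is3Clique_triple_iff.2 ⟨huv, huw, hvw⟩)).1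
  rw [← h, ← Set.ncard_coe_finset]
  congr 1
  ext x
  simp [linkVerts]

theorem IsFascinating.link_closed (hG : IsFascinating G) {u v : V} (huv : G.Adj u v)
    {p : V → Prop} (hp : ∀ x y, G.Adj u x → G.Adj v x → G.Adj u y → G.Adj v y → G.Adj x y →
      p x → p y) {x y : V} (hux : G.Adj u x) (hvx : G.Adj v x) (huy : G.Adj u y) (hvy : G.Adj v y)
    (hx : p x) : p y := by
  obtain ⟨l, hl, -, ⟨φ⟩⟩ := hG.edge_link u v huv
  have hc : (link G {u, v}).Preconnected := φ.preconnected_iff.2 SimpleGraph.cycleGraph_preconnected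
  obtain ⟨q⟩ := hc ⟨x, mem_linkVerts_pair.2 ⟨hux, hvx⟩⟩ ⟨y, mem_linkVerts_pair.2 ⟨huy, hvy⟩⟩
  have gen : ∀ (a b : linkVerts G {u, v}), (link G {u, v}).Walk a b → p a → p b := by
    intro a b r
    induction r with
    | nil => exact id
    | @cons a b c h r ih =>
      intro ha
      have h1 := mem_linkVerts_pair.1 a.2
      have h2 := mem_linkVerts_pair.1 b.2
      exact ih (hp _ _ h1.1 h1.2 h2.1 h2.2 h ha)
  exact gen _ _ q hx

/-- The link of v is a closed surface: triangle links of size two put each of its edges in two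
triangles, and edge links being connected makes its own vertex links connected. -/
theorem IsFascinating.le_link_count (hG : IsFascinating G) (v : V) :
    6 * G.degree v ≤ eb G (G.neighborFinset v) (G.neighborFinset v) + 12 := by
  classical
  let W := linkVerts G {v}
  let H : SimpleGraph W := link G {v}
  have hW : ∀ w : W, G.Adj v w := fun w => mem_linkVerts_singleton.1 w.2
  have hA : ∀ w x : W, H.Adj w x ↔ G.Adj w x := fun w x => Iff.rfl
  have hN : ∀ S : Finset W, #S = #(S.map (Function.Embedding.subtype _)) := fun S => (card_map _).symm
  have hedge : ∀ w x, H.Adj w x → #(H.neighborFinset w ∩ H.neighborFinset x) = 2 := by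
    intro w x hwx
    rw [← hG.triangle_card (hW w) (hW x) hwx, hN]
    congr 1
    ext y
    simp only [mem_map, mem_inter, SimpleGraph.mem_neighborFinset, Function.Embedding.subtype_apply]
    constructor
    · rintro ⟨z, ⟨h1, h2⟩, rfl⟩
      exact ⟨⟨hW z, h1⟩, h2⟩
    · rintro ⟨⟨h1, h2⟩, h3⟩
      exact ⟨⟨y, mem_linkVerts_singleton.2 h1⟩, ⟨h2, h3⟩, rfl⟩
  have hlink : ∀ w (f : W → ZMod 2), (∀ x y, H.Adj w x → H.Adj w y → H.Adj x y → f x = f y) →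
      ∀ x y, H.Adj w x → H.Adj w y → f x = f y := by
    intro w f hf x y hx hy
    have := hG.link_closed (hW w) (p := fun z => ∀ h : G.Adj v z,
      f ⟨z, mem_linkVerts_singleton.2 h⟩ = f x) (by
        intro a b ha1 ha2 hb1 hb2 hab h h'
        rw [← h ha1]
        exact (hf ⟨a, mem_linkVerts_singleton.2 ha1⟩ ⟨b, mem_linkVerts_singleton.2 hb1⟩
          ha2 hb2 hab).symm) (hW x) hx (hW y) hy (fun _ => rfl)
    exact (this (hW y)).symm
  have h := three_mul_card_le_card_edges (H := H) (hG.vertex_link_connected v) hedge hlink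
  have hcard : Fintype.card W = G.degree v := by
    rw [← card_univ, hN, ← SimpleGraph.card_neighborFinset_eq_degree]
    congr 1
    ext y
    simp only [mem_map, mem_univ, true_and, Function.Embedding.subtype_apply,
      SimpleGraph.mem_neighborFinset]
    exact ⟨by rintro ⟨z, rfl⟩; exact hW z, fun hy => ⟨⟨y, mem_linkVerts_singleton.2 hy⟩, rfl⟩⟩
  have hE : eb G (G.neighborFinset v) (G.neighborFinset v) = 2 * #H.edgeFinset := by
    rw [← H.sum_degrees_eq_twice_card_edges, eb,
      sum_subtype (F := inferInstanceAs (Fintype W)) (p := fun w => w ∈ linkVerts G {v}) _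
        (by simp [mem_linkVerts_singleton])]
    refine sum_congr rfl fun w _ => ?_
    rw [dg_eq_card_inter, ← SimpleGraph.card_neighborFinset_eq_degree, hN]
    congr 1
    ext y
    simp only [mem_map, mem_inter, SimpleGraph.mem_neighborFinset, Function.Embedding.subtype_apply]
    constructor
    · rintro ⟨h1, h2⟩
      exact ⟨⟨y, mem_linkVerts_singleton.2 h2⟩, h1, rfl⟩
    · rintro ⟨z, h1, rfl⟩
      exact ⟨h1, hW z⟩
  omega

theorem IsFascinating.isFlagSphereLike (hG : IsFascinating G) : IsFlagSphereLike G where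
  six_le_degree v := by
    have h := hG.vertex_link_card v
    rwa [show linkVerts G {v} = (G.neighborFinset v : Set V) by
      ext w; simp [mem_linkVerts_singleton], Set.ncard_coe_finset,
      SimpleGraph.card_neighborFinset_eq_degree] at h
  link_count := by
    -- Condition (a) says that the inequalities `le_link_count` sum to an equality, so each of them
    -- is one.
    have h1 : ∑ v, (6 * G.degree v) = ∑ v, (eb G (G.neighborFinset v) (G.neighborFinset v) + 12) := by
      have h := hG.card_triangles
      rw [sum_add_distrib, sum_eb_neighborFinset, ← mul_sum, G.sum_degrees_eq_twice_card_edges,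
        sum_const, smul_eq_mul, card_univ]
      omega
    intro v
    exact ((sum_eq_sum_iff_of_le fun v _ => hG.le_link_count v).1 h1 v (mem_univ v)).symm
  four_le u v huv := by
    obtain ⟨l, -, hl, ⟨φ⟩⟩ := hG.edge_link u v huv
    have h1 : Nat.card (linkVerts G {u, v}) = l := by
      rw [Nat.card_congr φ.toEquiv, Nat.card_fin]
    rw [Nat.card_coe_set_eq, show linkVerts G {u, v} =
      (G.neighborFinset u ∩ G.neighborFinset v : Finset V) by
        ext w; simp [mem_linkVerts_pair], Set.ncard_coe_finset] at h1
    omega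
  triangle u v w := hG.triangle_card
  not_adj u v w x y huv huw hvw hux hvx hwx huy hvy hwy hxy := by
    have h := (hG.triangle_link {u, v, w}
      (SimpleGraph.is3Clique_triple_iff.2 ⟨huv, huw, hvw⟩)).2
    have hx : x ∈ linkVerts G (({u, v, w} : Finset V) : Set V) := by simp [linkVerts, *]
    have hy : y ∈ linkVerts G (({u, v, w} : Finset V) : Set V) := by simp [linkVerts, *]
    have : (link G (({u, v, w} : Finset V) : Set V)).Adj ⟨x, hx⟩ ⟨y, hy⟩ := hxy
    rw [h] at this
    exact this
  link_conn u v huv S hS hne hcl := by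
    obtain ⟨x, hx⟩ := hne
    refine hS.antisymm fun y hy => ?_
    have hx' := hS hx
    simp only [mem_inter, SimpleGraph.mem_neighborFinset] at hx' hy
    refine hG.link_closed huv (p := (· ∈ S)) ?_ hx'.1 hx'.2 hy.1 hy.2 hx
    intro a b _ _ h1 h2 hab ha
    exact hcl a ha b (by simp [h1, h2]) hab

end Counting

/-! ### Two-coloured links -/

section Links

set_option linter.unusedSectionVars false

variable {V : Type*} [Fintype V] [DecidableEq V] {G : SimpleGraph V} [DecidableRel G.Adj]

/-- The number of triangles in `S × T × U`. -/
def tri (G : SimpleGraph V) [DecidableRel G.Adj] (S T U : Finset V) : ℕ :=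
  ∑ s ∈ S, ∑ t ∈ T, ∑ u ∈ U, if G.Adj s t ∧ G.Adj s u ∧ G.Adj t u then 1 else 0

theorem tri_swap_right (S T U : Finset V) : tri G S T U = tri G S U T := by
  unfold tri
  refine sum_congr rfl fun s _ => ?_
  rw [sum_comm]
  refine sum_congr rfl fun u _ => sum_congr rfl fun t _ => ?_
  exact if_congr (by rw [G.adj_comm t u]; tauto) rfl rfl

theorem tri_swap_left (S T U : Finset V) : tri G S T U = tri G T S U := by
  unfold tri
  rw [sum_comm]
  refine sum_congr rfl fun t _ => sum_congr rfl fun s _ => sum_congr rfl fun u _ => ?_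
  exact if_congr (by rw [G.adj_comm t s]; tauto) rfl rfl

theorem tri_union_right {T U : Finset V} (h : Disjoint T U) (R S : Finset V) :
    tri G R S (T ∪ U) = tri G R S T + tri G R S U := by
  simp only [tri, sum_union h, sum_add_distrib]

theorem tri_eq_zero {S : Finset V}
    (h : ∀ x ∈ S, ∀ y ∈ S, ∀ z ∈ S, G.Adj x y → G.Adj x z → ¬ G.Adj y z) : tri G S S S = 0 :=
  sum_eq_zero fun x hx => sum_eq_zero fun y hy => sum_eq_zero fun z hz =>
    if_neg fun h' => h x hx y hy z hz h'.1 h'.2.1 h'.2.2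

theorem sdiff_inter_of_subset_union {N Z Y : Finset V} (hd : Disjoint Z Y) (h : N ⊆ Z ∪ Y) :
    N \ (N ∩ Z) = N ∩ Y := by
  ext w
  have h1 : w ∈ Z → w ∉ Y := fun h => Finset.disjoint_left.1 hd h
  have h2 := @h w
  simp only [mem_sdiff, mem_inter, mem_union] at *
  tauto

namespace IsFlagSphereLike

theorem tri_neighborFinset (hG : IsFlagSphereLike G) {v : V} {S T : Finset V}
    (hS : S ⊆ G.neighborFinset v) (hT : T ⊆ G.neighborFinset v) : tri G S T (G.neighborFinset v) = 2 * eb G S T := by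
  unfold tri eb
  rw [mul_sum]
  refine sum_congr rfl fun s hs => ?_
  rw [dg, card_filter, mul_sum]
  refine sum_congr rfl fun t ht => ?_
  split_ifs with hst
  · have h := hG.triangle v s t (by simpa using hS hs) (by simpa using hT ht) hst
    rw [mul_one, ← h, ← card_filter]
    congr 1
    ext x
    simp [hst]
  · simp [hst]

theorem eb_split (hG : IsFlagSphereLike G) {v : V} {P : Finset V} (hP : P ⊆ G.neighborFinset v) :
    eb G P P + eb G (G.neighborFinset v \ P) (G.neighborFinset v \ P) +
      2 * eb G P (G.neighborFinset v \ P) + 12 = 6 * G.degree v := by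
  have h := hG.link_count v
  have hd : Disjoint P (G.neighborFinset v \ P) := disjoint_sdiff
  nth_rewrite 1 2 [← union_sdiff_of_subset hP] at h
  rw [eb_union_left hd, eb_union_right hd, eb_union_right hd, eb_comm (_ \ P) P] at h
  omega

/-- Every link edge lies in two link triangles, and a mixed triangle has two bichromatic edges and
one monochromatic edge. So there are as many mixed triangles as bichromatic edges, and the remaining
incidences of monochromatic edges come from monochromatic triangles, each counted six times by
`tri`. -/
theorem tri_split (hG : IsFlagSphereLike G) {v : V} {P : Finset V} (hP : P ⊆ G.neighborFinset v) :
    2 * eb G P (G.neighborFinset v \ P) + tri G P P P +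
      tri G (G.neighborFinset v \ P) (G.neighborFinset v \ P) (G.neighborFinset v \ P) =
    2 * eb G P P + 2 * eb G (G.neighborFinset v \ P) (G.neighborFinset v \ P) := by
  have hQ : G.neighborFinset v \ P ⊆ G.neighborFinset v := sdiff_subset
  have hd : Disjoint P (G.neighborFinset v \ P) := disjoint_sdiff
  have h1 := hG.tri_neighborFinset hP hP
  have h2 := hG.tri_neighborFinset hP hQ
  have h3 := hG.tri_neighborFinset hQ hQ
  set Q := G.neighborFinset v \ P
  rw [show G.neighborFinset v = P ∪ Q from (union_sdiff_of_subset hP).symm,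
    tri_union_right hd] at h1 h2 h3
  rw [tri_swap_right P Q P, tri_swap_left P Q Q, tri_swap_right Q P Q] at h2
  omega

theorem eb_cross_le (hG : IsFlagSphereLike G) {v : V} {P : Finset V} (hP : P ⊆ G.neighborFinset v) :
    eb G P (G.neighborFinset v \ P) + 4 ≤ 2 * G.degree v := by
  have h1 := hG.eb_split hP
  have h2 := hG.tri_split hP
  omega

theorem le_eb_inner (hG : IsFlagSphereLike G) {v : V} {P : Finset V} (hP : P ⊆ G.neighborFinset v) :
    2 * G.degree v ≤
      eb G P P + eb G (G.neighborFinset v \ P) (G.neighborFinset v \ P) + 4 := by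
  have h1 := hG.eb_split hP
  have h2 := hG.tri_split hP
  omega

theorem eb_cross_eq (hG : IsFlagSphereLike G) {v : V} {P : Finset V} (hP : P ⊆ G.neighborFinset v)
    (h : ∀ x ∈ P, ∀ y ∈ P, ∀ z ∈ P, G.Adj x y → G.Adj x z → ¬ G.Adj y z)
    (h' : ∀ x ∈ G.neighborFinset v \ P, ∀ y ∈ G.neighborFinset v \ P,
      ∀ z ∈ G.neighborFinset v \ P, G.Adj x y → G.Adj x z → ¬ G.Adj y z) :
    eb G P (G.neighborFinset v \ P) + 4 = 2 * G.degree v := by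
  have h1 := hG.eb_split hP
  have h2 := hG.tri_split hP
  rw [tri_eq_zero h, tri_eq_zero h'] at h2
  omega

theorem dg_edge_link (hG : IsFlagSphereLike G) {u v x : V} (huv : G.Adj u v)
    (hx : x ∈ G.neighborFinset u ∩ G.neighborFinset v) :
    dg G x (G.neighborFinset u ∩ G.neighborFinset v) = 2 := by
  simp only [mem_inter, SimpleGraph.mem_neighborFinset] at hx
  rw [dg_eq_card_inter, inter_comm, hG.triangle u v x huv hx.1 hx.2]

/-- The edge link is connected and 2-regular. Average degree two inside `S` means that no vertex of
`S` has a neighbour in the link outside `S`. -/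
theorem eq_edge_link (hG : IsFlagSphereLike G) {u v : V} (huv : G.Adj u v) {S : Finset V}
    (hS : S ⊆ G.neighborFinset u ∩ G.neighborFinset v) (hne : S.Nonempty)
    (h : 2 * #S ≤ eb G S S) : S = G.neighborFinset u ∩ G.neighborFinset v := by
  refine hG.link_conn u v huv S hS hne ?_
  have hle : ∀ x ∈ S, dg G x S ≤ 2 := fun x hx =>
    (dg_mono hS x).trans (hG.dg_edge_link huv (hS hx)).le
  have heq : ∀ x ∈ S, dg G x S = 2 := by
    refine (sum_eq_sum_iff_of_le hle).1 (le_antisymm (sum_le_sum hle) ?_)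
    rw [sum_const, smul_eq_mul, mul_comm]
    exact h
  intro x hx y hy hxy
  have h1 : ({z ∈ S | G.Adj x z} : Finset V) =
      ({z ∈ G.neighborFinset u ∩ G.neighborFinset v | G.Adj x z} : Finset V) := by
    refine eq_of_subset_of_card_le (filter_subset_filter _ hS) ?_
    exact (hG.dg_edge_link huv (hS hx)).le.trans (heq x hx).ge
  have h2 : y ∈ ({z ∈ S | G.Adj x z} : Finset V) := by rw [h1]; simp [hy, hxy]
  exact (mem_filter.1 h2).1

/-- Such a triangle together with u and v would be five pairwise adjacent vertices. -/
theorem edge_link_no_triangle (hG : IsFlagSphereLike G) {u v : V} (huv : G.Adj u v) :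
    ∀ x ∈ G.neighborFinset u ∩ G.neighborFinset v, ∀ y ∈ G.neighborFinset u ∩ G.neighborFinset v,
    ∀ z ∈ G.neighborFinset u ∩ G.neighborFinset v, G.Adj x y → G.Adj x z → ¬ G.Adj y z := by
  intro x hx y hy z hz hxy hxz
  simp only [mem_inter, SimpleGraph.mem_neighborFinset] at hx hy hz
  exact hG.not_adj u v x y z huv hx.1 hx.2 hy.1 hy.2 hxy hz.1 hz.2 hxz

/-- If the links of two edges partition the vertices, every vertex of one is adjacent to every
vertex of the other. -/
theorem adj_of_partition (hG : IsFlagSphereLike G) {a a' b b' : V}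
    (ha : G.Adj a a') (hb : G.Adj b b')
    (hd : Disjoint (G.neighborFinset b ∩ G.neighborFinset b')
      (G.neighborFinset a ∩ G.neighborFinset a'))
    (hc : (G.neighborFinset b ∩ G.neighborFinset b') ∪
      (G.neighborFinset a ∩ G.neighborFinset a') = univ) :
    ∀ z ∈ G.neighborFinset b ∩ G.neighborFinset b',
    ∀ y ∈ G.neighborFinset a ∩ G.neighborFinset a', G.Adj z y := by
  set Z := G.neighborFinset b ∩ G.neighborFinset b' with hZ
  set Y := G.neighborFinset a ∩ G.neighborFinset a' with hY
  intro z hz y hy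
  -- Colour the link of y by Z and Y. Its two vertices in Y are non-adjacent, so the bound 2d - 4 =
  -- 2 * #P of `le_eb_inner` falls entirely on P, and `eq_edge_link` gives P = Z.
  set P := G.neighborFinset y ∩ Z with hP
  have hPN : P ⊆ G.neighborFinset y := inter_subset_left
  have hQ : G.neighborFinset y \ P = G.neighborFinset y ∩ Y :=
    sdiff_inter_of_subset_union hd (hc ▸ subset_univ _)
  have h := hG.le_eb_inner hPN
  have hQ2 : #(G.neighborFinset y ∩ Y) = 2 := by
    rw [← dg_eq_card_inter]; exact hG.dg_edge_link ha hy
  have hQ0 : eb G (G.neighborFinset y ∩ Y) (G.neighborFinset y ∩ Y) = 0 := by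
    refine sum_eq_zero fun w hw => ?_
    rw [dg, card_eq_zero, filter_eq_empty_iff]
    intro w' hw' hadj
    rw [mem_inter, SimpleGraph.mem_neighborFinset] at hw hw'
    exact hG.edge_link_no_triangle ha y hy w hw.2 w' hw'.2 hw.1 hw'.1 hadj
  have hcard : #P + 2 = G.degree y := by
    rw [← SimpleGraph.card_neighborFinset_eq_degree, ← hQ2, ← hQ, add_comm,
      card_sdiff_add_card_eq_card hPN]
  rw [hQ, hQ0] at h
  have h6 := hG.six_le_degree y
  have hPZ : P = Z := hG.eq_edge_link hb inter_subset_right (card_pos.1 (by omega)) (by omega)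
  have : z ∈ P := hPZ ▸ hz
  simp only [hP, mem_inter, SimpleGraph.mem_neighborFinset] at this
  exact this.1.symm

/-- The edge bound for a graph covered by the links of two edges and one more vertex. -/
theorem card_edges_le_of_extra_vertex (hG : IsFlagSphereLike G) {a a' b b' x : V}
    (ha : G.Adj a a') (hb : G.Adj b b')
    (hd : Disjoint (G.neighborFinset b ∩ G.neighborFinset b')
      (G.neighborFinset a ∩ G.neighborFinset a'))
    (hx : x ∉ (G.neighborFinset b ∩ G.neighborFinset b') ∪
      (G.neighborFinset a ∩ G.neighborFinset a'))
    (hc : insert x ((G.neighborFinset b ∩ G.neighborFinset b') ∪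
      (G.neighborFinset a ∩ G.neighborFinset a')) = univ)
    (hxZ : ¬ G.neighborFinset b ∩ G.neighborFinset b' ⊆ G.neighborFinset x)
    (hxY : ¬ G.neighborFinset a ∩ G.neighborFinset a' ⊆ G.neighborFinset x) :
    (4 * #G.edgeFinset : ℤ) ≤ (Fintype.card V : ℤ) ^ 2 + 2 * Fintype.card V + 17 := by
  have hZt := hG.edge_link_no_triangle hb
  have hYt := hG.edge_link_no_triangle ha
  have hZd : ∀ z ∈ _, _ = 2 := fun z hz => hG.dg_edge_link hb (x := z) hz
  have hYd : ∀ z ∈ _, _ = 2 := fun z hz => hG.dg_edge_link ha (x := z) hz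
  have hZe := fun S => hG.eq_edge_link hb (S := S)
  have hYe := fun S => hG.eq_edge_link ha (S := S)
  set Z := G.neighborFinset b ∩ G.neighborFinset b' with hZ
  set Y := G.neighborFinset a ∩ G.neighborFinset a' with hY
  have h6 := hG.six_le_degree x
  set P := G.neighborFinset x ∩ Z with hP
  set Q := G.neighborFinset x ∩ Y with hQdef
  have hPN : P ⊆ G.neighborFinset x := inter_subset_left
  have hQN : Q ⊆ G.neighborFinset x := inter_subset_left
  have hPZ : P ⊆ Z := inter_subset_right
  have hQY : Q ⊆ Y := inter_subset_right
  have hQ : G.neighborFinset x \ P = Q := by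
    refine sdiff_inter_of_subset_union hd fun w hw => ?_
    have h1 : w ∈ insert x (Z ∪ Y) := hc ▸ mem_univ w
    refine (mem_insert.1 h1).resolve_left ?_
    rintro rfl
    simp at hw
  have hcard : #P + #Q = G.degree x := by
    rw [← SimpleGraph.card_neighborFinset_eq_degree, ← hQ, add_comm,
      card_sdiff_add_card_eq_card hPN]
  have hPt : ∀ x ∈ P, ∀ y ∈ P, ∀ z ∈ P, G.Adj x y → G.Adj x z → ¬ G.Adj y z :=
    fun x hx y hy z hz => hZt x (hPZ hx) y (hPZ hy) z (hPZ hz)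
  have hQt : ∀ x ∈ Q, ∀ y ∈ Q, ∀ z ∈ Q, G.Adj x y → G.Adj x z → ¬ G.Adj y z :=
    fun x hx y hy z hz => hYt x (hQY hx) y (hQY hy) z (hQY hz)
  -- Without monochromatic triangles the colouring bound is an equality. With p = #P and q = #Q,
  -- exactly (p - 2)(q - 2) pairs of P × Q are therefore non-adjacent.
  have hcross := hG.eb_cross_eq hPN hPt (hQ.symm ▸ hQt)
  have hsplit := hG.eb_split hPN
  rw [hQ] at hcross hsplit
  have hPlt : P.Nonempty → eb G P P < 2 * #P := by
    intro hne
    by_contra hcon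
    exact hxZ ((hZe P hPZ hne (not_lt.1 hcon)) ▸ hPN)
  have hQlt : Q.Nonempty → eb G Q Q < 2 * #Q := by
    intro hne
    by_contra hcon
    exact hxY ((hYe Q hQY hne (not_lt.1 hcon)) ▸ hQN)
  have hPQ := eb_add_nb (G := G) P Q
  -- two edges of the link of `x` joined completely would give five pairwise adjacent vertices
  have hK : ∀ S T : Finset V, S ⊆ G.neighborFinset x → T ⊆ G.neighborFinset x → nb G S T = 0 →
      0 < eb G S S → 0 < eb G T T → False := by
    intro S T hS hT h0 h1 h2
    have hall : ∀ s ∈ S, ∀ t ∈ T, G.Adj s t := by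
      intro s hs t ht
      have := sum_eq_zero_iff.1 h0 s hs
      rw [nd, card_eq_zero, filter_eq_empty_iff] at this
      exact not_not.1 (this ht)
    have hedge : ∀ U : Finset V, 0 < eb G U U → ∃ u ∈ U, ∃ u' ∈ U, G.Adj u u' := by
      intro U hU
      obtain ⟨u, hu, hu'⟩ := exists_ne_zero_of_sum_ne_zero hU.ne'
      obtain ⟨u', hu''⟩ := card_pos.1 (Nat.pos_of_ne_zero hu')
      rw [mem_filter] at hu''
      exact ⟨u, hu, u', hu''.1, hu''.2⟩
    obtain ⟨s, hs, s', hs', hss⟩ := hedge S h1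
    obtain ⟨t, ht, t', ht', htt⟩ := hedge T h2
    have hxs : G.Adj x s := by simpa using hS hs
    have hxs' : G.Adj x s' := by simpa using hS hs'
    have hxt : G.Adj x t := by simpa using hT ht
    have hxt' : G.Adj x t' := by simpa using hT ht'
    exact hG.not_adj x s s' t t' hxs hxs' hss hxt (hall s hs t ht) (hall s' hs' t ht)
      hxt' (hall s hs t' ht') (hall s' hs' t' ht') htt
  -- For p ≤ 1 there is no room for 2d - 4 bichromatic edges. For p = 2 they are all the pairs of P
  -- × Q, and the 2q left for the inner counts exceeds what P or Q can supply alone, so both contain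
  -- an edge, against `hK`.
  have hP3 : 3 ≤ #P := by
    by_contra hlt
    have hQl := hQlt (card_pos.1 (by omega))
    obtain h | h | h : #P = 0 ∨ #P = 1 ∨ #P = 2 := by omega
    · rw [h] at hPQ; omega
    · rw [h] at hPQ; omega
    · rw [h] at hPQ
      exact hK P Q hPN hQN (by omega) (by omega)
        (by have := hPlt (card_pos.1 (by omega)); omega)
  have hQ3 : 3 ≤ #Q := by
    by_contra hlt
    have hPl := hPlt (card_pos.1 (by omega))
    obtain h | h | h : #Q = 0 ∨ #Q = 1 ∨ #Q = 2 := by omega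
    · rw [h] at hPQ; omega
    · rw [h] at hPQ; omega
    · rw [h] at hPQ
      exact hK P Q hPN hQN (by omega)
        (by have := hQlt (card_pos.1 (by omega)); omega) (by omega)
  have hZZ : eb G Z Z = 2 * #Z := by
    rw [eb, sum_congr rfl hZd, sum_const, smul_eq_mul, mul_comm]
  have hYY : eb G Y Y = 2 * #Y := by
    rw [eb, sum_congr rfl hYd, sum_const, smul_eq_mul, mul_comm]
  have hm := eb_univ (G := G)
  have hdx : Disjoint {x} (Z ∪ Y) := disjoint_singleton_left.2 hx
  rw [← hc, insert_eq, eb_union_left hdx, eb_union_right hdx, eb_union_right hdx,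
    eb_union_left hd, eb_union_left hd, eb_union_right hd, eb_union_right hd, eb_union_right hd,
    hZZ, hYY,
    eb_comm Y Z, eb_comm Z {x}, eb_comm Y {x}] at hm
  have e1 : eb G {x} {x} = 0 := by simp [eb, dg]
  have e2 : eb G {x} Z = #P := by rw [eb, sum_singleton, dg_eq_card_inter]
  have e3 : eb G {x} Y = #Q := by rw [eb, sum_singleton, dg_eq_card_inter]
  rw [e1, e2, e3] at hm
  have hn : Fintype.card V = 1 + (#Z + #Y) := by
    rw [← card_univ, ← hc, insert_eq, card_union_of_disjoint hdx, card_union_of_disjoint hd,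
      card_singleton]
  have hZY := eb_add_nb (G := G) Z Y
  have hmono := nb_mono (G := G) hPZ hQY
  rw [hn]
  zify at hm hZY hmono hPQ hcross hcard hP3 hQ3
  push_cast
  -- Here m ≤ |Z| + |Y| + |Z||Y| + p + q - (p - 2)(q - 2), where the terms in p and q equal 5 - (p -
  -- 3)(q - 3) ≤ 5. With |Z| + |Y| = n - 1 this is the bound with constant 17.
  nlinarith [sq_nonneg ((#Z : ℤ) - #Y), mul_nonneg (sub_nonneg.2 hP3) (sub_nonneg.2 hQ3)]

end IsFlagSphereLike

theorem IsFascinating.isJoinOfTwoCycles (hG : IsFascinating G) {a a' b b' : V}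
    (ha : G.Adj a a') (hb : G.Adj b b')
    (hd : Disjoint (G.neighborFinset b ∩ G.neighborFinset b')
      (G.neighborFinset a ∩ G.neighborFinset a'))
    (hc : (G.neighborFinset b ∩ G.neighborFinset b') ∪
      (G.neighborFinset a ∩ G.neighborFinset a') = univ) : IsJoinOfTwoCycles G := by
  have hadj := hG.isFlagSphereLike.adj_of_partition ha hb hd hc
  obtain ⟨k, hk, -, ⟨φ⟩⟩ := hG.edge_link b b' hb
  obtain ⟨l, hl, -, ⟨ψ⟩⟩ := hG.edge_link a a' ha
  refine ⟨k, l, hk, hl, ?_⟩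
  have hφ : ∀ i, (φ.symm i).1 ∈ G.neighborFinset b ∩ G.neighborFinset b' := fun i => by
    simpa using mem_linkVerts_pair.1 (φ.symm i).2
  have hψ : ∀ i, (ψ.symm i).1 ∈ G.neighborFinset a ∩ G.neighborFinset a' := fun i => by
    simpa using mem_linkVerts_pair.1 (ψ.symm i).2
  let f : Fin k ⊕ Fin l → V := Sum.elim (fun i => (φ.symm i).1) (fun j => (ψ.symm j).1)
  have hinj : Function.Injective f := by
    refine Function.Injective.sumElim (Subtype.val_injective.comp φ.symm.injective)
      (Subtype.val_injective.comp ψ.symm.injective) fun i j hij => ?_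
    exact Finset.disjoint_left.1 hd (hφ i) (hij ▸ hψ j)
  have hsurj : Function.Surjective f := by
    intro x
    have hx : x ∈ (G.neighborFinset b ∩ G.neighborFinset b') ∪
      (G.neighborFinset a ∩ G.neighborFinset a') := hc ▸ mem_univ x
    simp only [mem_union, mem_inter, SimpleGraph.mem_neighborFinset] at hx
    rcases hx with hx | hx
    · exact ⟨Sum.inl (φ ⟨x, mem_linkVerts_pair.2 hx⟩), by simp [f]⟩
    · exact ⟨Sum.inr (ψ ⟨x, mem_linkVerts_pair.2 hx⟩), by simp [f]⟩
  let e : join (SimpleGraph.cycleGraph k) (SimpleGraph.cycleGraph l) ≃g G :=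
    { Equiv.ofBijective f ⟨hinj, hsurj⟩ with
      map_rel_iff' := by
        rintro (i | i) (j | j)
        · change G.Adj (f (Sum.inl i)) (f (Sum.inl j)) ↔ _
          have h := φ.symm.map_adj_iff (v := i) (w := j)
          have h2 : (link G {b, b'}).Adj (φ.symm i) (φ.symm j) ↔
            G.Adj (φ.symm i).1 (φ.symm j).1 := Iff.rfl
          simpa [f, join, h2] using h
        · change G.Adj (f (Sum.inl i)) (f (Sum.inr j)) ↔ _
          simpa [f, join] using hadj _ (hφ i) _ (hψ j)
        · change G.Adj (f (Sum.inr i)) (f (Sum.inl j)) ↔ _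
          simpa [f, join] using (hadj _ (hφ j) _ (hψ i)).symm
        · change G.Adj (f (Sum.inr i)) (f (Sum.inr j)) ↔ _
          have h := ψ.symm.map_adj_iff (v := i) (w := j)
          have h2 : (link G {a, a'}).Adj (ψ.symm i) (ψ.symm j) ↔
            G.Adj (ψ.symm i).1 (ψ.symm j).1 := Iff.rfl
          simpa [f, join, h2] using h }
  exact ⟨e.symm⟩

theorem IsFascinating.isJoinOfTwoCycles_of_cover (hG : IsFascinating G) {a a' b b' : V}
    (ha : G.Adj a a') (hb : G.Adj b b')
    (hd : Disjoint (G.neighborFinset b ∩ G.neighborFinset b')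
      (G.neighborFinset a ∩ G.neighborFinset a'))
    (hc : #((G.neighborFinset b ∩ G.neighborFinset b') ∪
      (G.neighborFinset a ∩ G.neighborFinset a'))ᶜ ≤ 1)
    (hx : ∀ x ∉ (G.neighborFinset b ∩ G.neighborFinset b') ∪
      (G.neighborFinset a ∩ G.neighborFinset a'),
      ¬ G.neighborFinset b ∩ G.neighborFinset b' ⊆ G.neighborFinset x ∧
      ¬ G.neighborFinset a ∩ G.neighborFinset a' ⊆ G.neighborFinset x)
    (hm : (Fintype.card V : ℤ) ^ 2 + 2 * Fintype.card V + 17 < 4 * #G.edgeFinset) :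
    IsJoinOfTwoCycles G := by
  rcases Nat.lt_or_ge 0 (#((G.neighborFinset b ∩ G.neighborFinset b') ∪
      (G.neighborFinset a ∩ G.neighborFinset a'))ᶜ) with h0 | h0
  · obtain ⟨x, hx1⟩ := card_eq_one.1 (le_antisymm hc h0)
    have hxn : x ∉ (G.neighborFinset b ∩ G.neighborFinset b') ∪
      (G.neighborFinset a ∩ G.neighborFinset a') := by
      rw [← mem_compl, hx1, mem_singleton]
    refine absurd (hG.isFlagSphereLike.card_edges_le_of_extra_vertex ha hb hd hxn ?_
      (hx x hxn).1 (hx x hxn).2) (not_le.2 hm)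
    rw [insert_eq, ← hx1, union_comm, union_compl]
  · refine hG.isJoinOfTwoCycles ha hb hd ?_
    rw [← compl_eq_empty_iff, ← card_eq_zero]
    omega

end Links

/-! ### The approximate structure -/

section Split

set_option linter.unusedSectionVars false

variable {V : Type*} [Fintype V] [DecidableEq V] {G : SimpleGraph V} [DecidableRel G.Adj]

/-- Otherwise d(u) + d(v) + 4 ≤ n + codegree on every edge. Summing, with codegree sums 6d - 12 from
the links and Cauchy–Schwarz for the degrees, gives 4m ≤ n² + 2n. -/
theorem IsFlagSphereLike.exists_adj_card_union (hG : IsFlagSphereLike G)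
    (hm : (Fintype.card V : ℤ) ^ 2 + 2 * Fintype.card V + 17 < 4 * #G.edgeFinset) :
    ∃ u v, G.Adj u v ∧ Fintype.card V ≤ #(G.neighborFinset u ∪ G.neighborFinset v) + 3 := by
  by_contra! hcon
  set n := Fintype.card V with hn
  have h1 : ∀ u, ∑ v ∈ G.neighborFinset u, (G.degree u + G.degree v + 4) + 12 ≤
      G.degree u * n + 6 * G.degree u := by
    intro u
    rw [← hG.link_count u, ← add_assoc, ← SimpleGraph.card_neighborFinset_eq_degree, ← smul_eq_mul,
      ← sum_const, eb, ← sum_add_distrib]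
    refine Nat.add_le_add_right (sum_le_sum fun v hv => ?_) _
    have h2 := hcon u v (by simpa using hv)
    have h3 := card_union_add_card_inter (G.neighborFinset u) (G.neighborFinset v)
    rw [dg_eq_card_inter, inter_comm, ← SimpleGraph.card_neighborFinset_eq_degree]
    omega
  have h2 : ∑ u, ∑ v ∈ G.neighborFinset u, G.degree v = ∑ u, G.degree u ^ 2 := by
    have : ∀ u v, (v ∈ G.neighborFinset u ↔ u ∈ G.neighborFinset v) := by
      intro u v; simp [G.adj_comm]
    rw [sum_comm' (t' := univ) (s' := fun v => G.neighborFinset v) (by intro u v; simp [this u v])]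
    refine sum_congr rfl fun u _ => ?_
    rw [sum_const, SimpleGraph.card_neighborFinset_eq_degree, smul_eq_mul, sq]
  have h3 := sum_le_sum fun u (_ : u ∈ univ) => h1 u
  have h4 : ∀ u, ∑ v ∈ G.neighborFinset u, (G.degree u + G.degree v + 4) =
      G.degree u ^ 2 + ∑ v ∈ G.neighborFinset u, G.degree v + 4 * G.degree u := by
    intro u
    rw [sum_add_distrib, sum_add_distrib, sum_const, sum_const,
      SimpleGraph.card_neighborFinset_eq_degree, smul_eq_mul, smul_eq_mul]
    ring
  simp only [h4, sum_add_distrib, ← mul_sum, ← sum_mul, h2, G.sum_degrees_eq_twice_card_edges,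
    sum_const, card_univ, smul_eq_mul, ← hn] at h3
  have h5 := sq_sum_le_card_mul_sum_sq (s := (univ : Finset V)) (f := fun v => G.degree v)
  rw [G.sum_degrees_eq_twice_card_edges, card_univ, ← hn] at h5
  set S := ∑ v, G.degree v ^ 2
  set m := #G.edgeFinset
  zify at h3 h5
  have hn0 : (0 : ℤ) ≤ n := by positivity
  have hm0 : (0 : ℤ) < m := by nlinarith
  have h6 := mul_le_mul_of_nonneg_left h3 hn0
  nlinarith [mul_pos hm0 (sub_pos.2 hm)]

/-- One side is N(u), the other lies in N(v) up to three vertices. Links contribute at most 6n each,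
the exceptional vertices another 6n. -/
theorem IsFlagSphereLike.exists_sparse_sides (hG : IsFlagSphereLike G)
    (hm : (Fintype.card V : ℤ) ^ 2 + 2 * Fintype.card V + 17 < 4 * #G.edgeFinset) :
    ∃ A : Finset V, eb G A A + eb G Aᶜ Aᶜ ≤ 18 * Fintype.card V := by
  obtain ⟨u, v, -, h⟩ := hG.exists_adj_card_union hm
  have hdeg : ∀ x, G.degree x ≤ Fintype.card V := fun x => (G.degree_lt_card_verts x).le
  refine ⟨(G.neighborFinset u)ᶜ, ?_⟩
  rw [compl_compl]
  set A := (G.neighborFinset u)ᶜ with hA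
  have h1 := hG.link_count u
  have h2 := hG.link_count v
  have h3 : #(A \ G.neighborFinset v) ≤ 3 := by
    have : A \ G.neighborFinset v = (G.neighborFinset u ∪ G.neighborFinset v)ᶜ := by
      ext; simp [hA]
    rw [this, card_compl]
    omega
  have h4 : ∀ S, eb G (A \ G.neighborFinset v) S ≤ 3 * Fintype.card V := by
    intro S
    calc eb G (A \ G.neighborFinset v) S ≤ ∑ x ∈ A \ G.neighborFinset v, Fintype.card V :=
          sum_le_sum fun x _ => (dg_le_degree x S).trans (hdeg x)
      _ ≤ _ := by rw [sum_const, smul_eq_mul]; gcongr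
  have h5 : eb G A A ≤ eb G (G.neighborFinset v) (G.neighborFinset v) + 6 * Fintype.card V := by
    have hd : Disjoint (A \ G.neighborFinset v) (A ∩ G.neighborFinset v) :=
      disjoint_sdiff_inter _ _
    have hu : A = (A \ G.neighborFinset v) ∪ (A ∩ G.neighborFinset v) :=
      (sdiff_union_inter _ _).symm
    have e1 : eb G A A = eb G (A \ G.neighborFinset v) A + eb G (A ∩ G.neighborFinset v) A := by
      rw [← eb_union_left hd, ← hu]
    have e2 : eb G (A ∩ G.neighborFinset v) A = eb G (A \ G.neighborFinset v)
        (A ∩ G.neighborFinset v) + eb G (A ∩ G.neighborFinset v) (A ∩ G.neighborFinset v) := by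
      rw [eb_comm, ← eb_union_left hd, ← hu]
    have e3 : eb G (A ∩ G.neighborFinset v) (A ∩ G.neighborFinset v) ≤
        eb G (G.neighborFinset v) (G.neighborFinset v) :=
      eb_mono inter_subset_right inter_subset_right
    have := h4 A
    have := h4 (A ∩ G.neighborFinset v)
    omega
  have := hdeg u
  have := hdeg v
  omega

theorem balanced_of_mul_large {p q n C : ℕ} (hpq : p + q ≤ n) (h : n ^ 2 ≤ 4 * (p * q) + 4 * C * n)
    (hn : 1000000 * C < n) : 499 * n ≤ 1000 * p := by
  by_contra hcon
  have h1 : p * q ≤ p * (n - p) := Nat.mul_le_mul_left _ (by omega)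
  obtain ⟨r, rfl⟩ : ∃ r, n = p + r := ⟨n - p, by omega⟩
  rw [Nat.add_sub_cancel_left] at h1
  have h2 : (p + r : ℤ) ^ 2 ≤ 4 * (p * r) + 4 * C * (p + r) := by
    exact_mod_cast h.trans (by gcongr)
  have h3 : ((p : ℤ) + r) < 500 * ((r : ℤ) - p) := by omega
  have h4 : 1000000 * (C : ℤ) < p + r := by exact_mod_cast hn
  have h5 : ((p : ℤ) + r) ^ 2 < (500 * ((r : ℤ) - p)) ^ 2 :=
    pow_lt_pow_left₀ h3 (by positivity) (by norm_num)
  nlinarith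

theorem mul_card_le {S T : Finset V} {c k : ℕ} (h : ∀ x ∈ S, c ≤ k * nd G x T) :
    #S * c ≤ k * nb G S T := by
  rw [nb, mul_sum, ← smul_eq_mul, ← sum_const]
  exact sum_le_sum h

/-- The vertices with many neighbours in `T`. -/
def rich (G : SimpleGraph V) [DecidableRel G.Adj] (T : Finset V) : Finset V :=
  {x | Fintype.card V ≤ 1000000 * dg G x T}

theorem mem_rich {T : Finset V} {x : V} :
    x ∈ rich G T ↔ Fintype.card V ≤ 1000000 * dg G x T := by simp [rich]

/-- A partition of the vertices, up to boundedly many vertices of small degree, into two parts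
inside which all degrees are bounded. -/
structure IsSplit (G : SimpleGraph V) [DecidableRel G.Adj] (A B : Finset V) : Prop where
  disj : Disjoint A B
  card_rest : #(A ∪ B)ᶜ ≤ 54
  dg_left : ∀ x ∈ A, dg G x A ≤ 12000000
  dg_right : ∀ x ∈ B, dg G x B ≤ 12000000
  degree_rest : ∀ x ∈ (A ∪ B)ᶜ, 1000000 * G.degree x ≤ 2 * Fintype.card V

theorem IsSplit.symm {A B : Finset V} (h : IsSplit G A B) : IsSplit G B A where
  disj := h.disj.symm
  card_rest := by rw [union_comm]; exact h.card_rest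
  dg_left := h.dg_right
  dg_right := h.dg_left
  degree_rest := by rw [union_comm]; exact h.degree_rest

/-- A vertex that is not rich misses at least n/3 vertices of `T`, so at most 3 · 9 of them fit into
9n missing pairs. -/
theorem card_sdiff_rich_le {S T : Finset V} (hnb : nb G S T ≤ 9 * Fintype.card V)
    (hT : 499 * Fintype.card V ≤ 1000 * #T) (hn : 0 < Fintype.card V) : #(S \ rich G T) ≤ 27 := by
  have h1 : #(S \ rich G T) * Fintype.card V ≤ 3 * nb G (S \ rich G T) T := by
    refine mul_card_le fun x hx => ?_
    have h2 := (mem_sdiff.1 hx).2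
    rw [mem_rich] at h2
    have := dg_add_nd (G := G) x T
    omega
  have h2 := nb_mono (G := G) (sdiff_subset : S \ rich G T ⊆ S) (subset_refl T)
  refine Nat.le_of_mul_le_mul_right (h1.trans ?_) hn
  omega

/-- Colour the link of x by `S` and `T`: fewer than 2d of the bichromatic pairs are adjacent, and
the rest are missing between `S` and `T`. Hence no vertex has many neighbours on both sides. -/
theorem IsFlagSphereLike.dg_mul_dg_le (hG : IsFlagSphereLike G) {S T : Finset V}
    (hd : Disjoint S T) (hST : S ∪ T = univ) (x : V) :
    dg G x S * dg G x T ≤ 2 * G.degree x + nb G S T := by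
  have hQ : G.neighborFinset x \ (G.neighborFinset x ∩ S) = G.neighborFinset x ∩ T :=
    sdiff_inter_of_subset_union hd (hST ▸ subset_univ _)
  have h1 := hG.eb_cross_le (inter_subset_left : G.neighborFinset x ∩ S ⊆ _)
  have h2 := eb_add_nb (G := G) (G.neighborFinset x ∩ S) (G.neighborFinset x ∩ T)
  have h3 := nb_mono (G := G) (inter_subset_right : G.neighborFinset x ∩ S ⊆ S)
    (inter_subset_right : G.neighborFinset x ∩ T ⊆ T)
  rw [hQ] at h1
  rw [dg_eq_card_inter, dg_eq_card_inter]
  omega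

/-- At least n/10⁶ neighbours in `T` leave at most 11 · 10⁶ in `S`, and `rich G T` exceeds `S` by at
most 27 vertices. -/
theorem dg_rich_le {S T : Finset V} (hST : S ∪ T = univ)
    (hmul : ∀ x, dg G x S * dg G x T ≤ 11 * Fintype.card V)
    (hdisj : Disjoint (rich G T) (rich G S)) (hT : #(T \ rich G S) ≤ 27)
    (hn : 0 < Fintype.card V) :
    ∀ x ∈ rich G T, dg G x (rich G T) ≤ 12000000 := by
  intro x hx
  have h1 : rich G T ⊆ S ∪ (T \ rich G S) := by
    intro y hy
    have h2 : y ∈ S ∪ T := hST ▸ mem_univ y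
    have h3 := Finset.disjoint_left.1 hdisj hy
    simp only [mem_union, mem_sdiff] at *
    tauto
  have h2 : dg G x (rich G T) ≤ dg G x S + 27 := by
    refine (card_le_card (filter_subset_filter _ h1)).trans ?_
    rw [filter_union]
    refine (card_union_le _ _).trans (Nat.add_le_add_left ((card_filter_le _ _).trans hT) _)
  rw [mem_rich] at hx
  have h3 : dg G x S * Fintype.card V ≤ 11000000 * Fintype.card V := by
    calc dg G x S * Fintype.card V ≤ dg G x S * (1000000 * dg G x T) := by gcongr
      _ = 1000000 * (dg G x S * dg G x T) := by ring
      _ ≤ 1000000 * (11 * Fintype.card V) := Nat.mul_le_mul_left _ (hmul x)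
      _ = _ := by ring
  have := Nat.le_of_mul_le_mul_right h3 hn
  omega

theorem IsFlagSphereLike.exists_isSplit (hG : IsFlagSphereLike G)
    (hm : (Fintype.card V : ℤ) ^ 2 + 2 * Fintype.card V + 17 < 4 * #G.edgeFinset)
    (hn : 10 ^ 60 ≤ Fintype.card V) : ∃ A B, IsSplit G A B := by
  obtain ⟨S, hS⟩ := hG.exists_sparse_sides hm
  have hd : Disjoint S Sᶜ := disjoint_compl_right
  have hu : S ∪ Sᶜ = univ := union_compl S
  have hc : #S + #Sᶜ = Fintype.card V := card_add_card_compl S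
  have hdeg : ∀ x, G.degree x ≤ Fintype.card V := fun x => (G.degree_lt_card_verts x).le
  have he := eb_univ (G := G)
  rw [← hu, eb_union_left hd, eb_union_right hd, eb_union_right hd, eb_comm Sᶜ S] at he
  have hp := eb_add_nb (G := G) S Sᶜ
  set T := Sᶜ
  set n := Fintype.card V with hnV
  norm_num at hn
  -- From n² < 4m = 2(inner counts) + 4|S||T| - 4 nb ≤ 36n + n² - 4 nb.
  have hnb : nb G S T ≤ 9 * n := by
    zify at hS hc he hp ⊢
    nlinarith [sq_nonneg ((#S : ℤ) - #T)]
  have hprod : n ^ 2 ≤ 4 * (#S * #T) + 4 * 9 * n := by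
    zify at hS hc he hp ⊢
    nlinarith
  have hSb : 499 * n ≤ 1000 * #S := balanced_of_mul_large hc.le hprod (by omega)
  have hTb : 499 * n ≤ 1000 * #T := by
    rw [mul_comm #S] at hprod
    exact balanced_of_mul_large (by omega) hprod (by omega)
  have hmul : ∀ x, dg G x S * dg G x T ≤ 11 * n := fun x => by
    have := hG.dg_mul_dg_le hd hu x
    have := hdeg x
    omega
  have hdisj : Disjoint (rich G T) (rich G S) := by
    rw [Finset.disjoint_left]
    intro x h1 h2
    rw [mem_rich, ← hnV] at h1 h2
    have h3 := Nat.mul_le_mul h1 h2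
    have h4 := hmul x
    nlinarith
  have hST : #(S \ rich G T) ≤ 27 := card_sdiff_rich_le hnb hTb (by omega)
  have hTS : #(T \ rich G S) ≤ 27 :=
    card_sdiff_rich_le (by rw [nb_comm]; exact hnb) hSb (by omega)
  refine ⟨rich G T, rich G S, hdisj, ?_, dg_rich_le hu hmul hdisj hTS (by omega),
    dg_rich_le (by rw [union_comm]; exact hu) (fun x => by rw [mul_comm]; exact hmul x)
      hdisj.symm hST (by omega), ?_⟩
  · have : (rich G T ∪ rich G S)ᶜ ⊆ (S \ rich G T) ∪ (T \ rich G S) := by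
      intro x hx
      have h2 : x ∈ S ∪ T := hu ▸ mem_univ x
      simp only [mem_compl, mem_union, mem_sdiff] at *
      tauto
    have := (card_le_card this).trans (card_union_le _ _)
    omega
  · intro x hx
    simp only [mem_compl, mem_union, mem_rich, not_or, not_le] at hx
    rw [← dg_univ, ← hu, dg_union hd]
    omega

end Split

/-! ### Pure vertices -/

section Pure

set_option linter.unusedSectionVars false

variable {V : Type*} [Fintype V] [DecidableEq V] {G : SimpleGraph V} [DecidableRel G.Adj]

/-- A split of a large dense graph with sphere-like links. -/
structure IsDenseSplit (G : SimpleGraph V) [DecidableRel G.Adj] (A B : Finset V) : Prop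
    extends IsSplit G A B where
  sphere : IsFlagSphereLike G
  dense : (Fintype.card V : ℤ) ^ 2 + 2 * Fintype.card V + 17 < 4 * #G.edgeFinset
  large : 10 ^ 60 ≤ Fintype.card V

/-- The vertices of `A` that are adjacent to almost all vertices of `B`. -/
def goodSet (G : SimpleGraph V) [DecidableRel G.Adj] (A B : Finset V) : Finset V :=
  {a ∈ A | 1000 * nd G a B ≤ Fintype.card V}

/-- The good vertices of `A` that have all their neighbours in `B` or among the good vertices. -/
def pureSet (G : SimpleGraph V) [DecidableRel G.Adj] (A B : Finset V) : Finset V :=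
  {a ∈ goodSet G A B | ∀ x, G.Adj a x → x ∈ B ∨ x ∈ goodSet G A B}

namespace IsDenseSplit

variable {A B : Finset V}

theorem symm (D : IsDenseSplit G A B) : IsDenseSplit G B A :=
  ⟨D.toIsSplit.symm, D.sphere, D.dense, D.large⟩

theorem card_add (D : IsDenseSplit G A B) : #A + #B + #(A ∪ B)ᶜ = Fintype.card V := by
  rw [← card_union_of_disjoint D.disj, card_add_card_compl]

theorem sum_rest_le (D : IsDenseSplit G A B) :
    1000000 * ∑ x ∈ (A ∪ B)ᶜ, G.degree x ≤ #(A ∪ B)ᶜ * (2 * Fintype.card V) := by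
  rw [mul_sum, ← smul_eq_mul (#_), ← sum_const]
  exact sum_le_sum D.degree_rest

theorem sum_rest_le' (D : IsDenseSplit G A B) :
    1000000 * ∑ x ∈ (A ∪ B)ᶜ, G.degree x ≤ 108 * Fintype.card V := by
  refine D.sum_rest_le.trans ?_
  have := Nat.mul_le_mul_right (2 * Fintype.card V) D.card_rest
  omega

theorem two_mul_edges_le (D : IsDenseSplit G A B) :
    2 * #G.edgeFinset ≤ eb G A A + eb G B B + 2 * eb G A B + 2 * ∑ x ∈ (A ∪ B)ᶜ, G.degree x := by
  have hd : Disjoint (A ∪ B) (A ∪ B)ᶜ := disjoint_compl_right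
  have h1 : eb G (A ∪ B) (A ∪ B) = eb G A A + eb G B B + 2 * eb G A B := by
    rw [eb_union_left D.disj, eb_union_right D.disj, eb_union_right D.disj, eb_comm B A]; ring
  have h2 : ∀ S, eb G (A ∪ B)ᶜ S ≤ ∑ x ∈ (A ∪ B)ᶜ, G.degree x :=
    fun S => sum_le_sum fun x _ => dg_le_degree x S
  have h3 : eb G (A ∪ B)ᶜ univ ≤ ∑ x ∈ (A ∪ B)ᶜ, G.degree x := h2 univ
  have h4 : eb G univ univ = eb G (A ∪ B) (A ∪ B) + eb G (A ∪ B)ᶜ (A ∪ B) + eb G (A ∪ B)ᶜ univ := by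
    rw [eb_comm (A ∪ B)ᶜ (A ∪ B), ← eb_union_right hd, union_compl,
      ← eb_union_left hd, union_compl]
  have := h2 (A ∪ B)
  rw [← eb_univ]
  omega

theorem eb_left_le (D : IsDenseSplit G A B) {S : Finset V} (hS : S ⊆ A) :
    eb G S A ≤ 12000000 * #S := by
  rw [mul_comm, ← smul_eq_mul, ← sum_const]
  exact sum_le_sum fun x hx => D.dg_left x (hS hx)

theorem nb_le (D : IsDenseSplit G A B) : nb G A B ≤ 6000001 * Fintype.card V := by
  have h1 := D.two_mul_edges_le
  have h2 := D.eb_left_le (subset_refl A)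
  have h3 := D.symm.eb_left_le (subset_refl B)
  have h4 := D.sum_rest_le'
  have h5 := eb_add_nb (G := G) A B
  have h6 := D.card_add
  have h7 := D.dense
  have h8 : 4 * (#A * #B) ≤ Fintype.card V ^ 2 := by
    rw [← h6]
    zify
    nlinarith [sq_nonneg ((#A : ℤ) - #B), mul_nonneg (by positivity : (0:ℤ) ≤ #A + #B)
      (by positivity : (0 : ℤ) ≤ #(A ∪ B)ᶜ)]
  zify at *
  nlinarith

theorem balanced (D : IsDenseSplit G A B) : 499 * Fintype.card V ≤ 1000 * #A := by
  have h1 := D.two_mul_edges_le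
  have h2 := D.eb_left_le (subset_refl A)
  have h3 := D.symm.eb_left_le (subset_refl B)
  have h4 := D.sum_rest_le'
  have h5 := eb_add_nb (G := G) A B
  have h6 := D.card_add
  have h7 := D.dense
  have h8 := D.large
  norm_num at h8
  refine balanced_of_mul_large (q := #B) (C := 6000001) (by omega) ?_ (by omega)
  zify at *
  nlinarith

theorem card_bad_le (D : IsDenseSplit G A B) : #(A \ goodSet G A B) ≤ 6000001000 := by
  have h1 : #(A \ goodSet G A B) * Fintype.card V ≤ 1000 * nb G (A \ goodSet G A B) B := by
    refine mul_card_le fun x hx => ?_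
    simp only [goodSet, mem_sdiff, mem_filter, not_and, not_le] at hx
    exact (hx.2 hx.1).le
  have h2 := nb_mono (G := G) (sdiff_subset : A \ goodSet G A B ⊆ A) (subset_refl B)
  have h3 := D.nb_le
  have h4 := D.large
  norm_num at h4
  refine Nat.le_of_mul_le_mul_right (c := Fintype.card V) (h1.trans ?_) (by omega)
  omega

theorem degree_le (D : IsDenseSplit G A B) {a : V} (ha : a ∈ A) :
    G.degree a ≤ dg G a B + 12000054 := by
  rw [← dg_univ, ← union_compl (A ∪ B), dg_union disjoint_compl_right, dg_union D.disj]
  have h1 := D.dg_left a ha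
  have h2 := (dg_le_card (G := G) a (A ∪ B)ᶜ).trans D.card_rest
  omega

/-- Three good neighbours of a would each be adjacent to almost all of N(a) ∩ B, giving nearly 3d
bichromatic edges in the link of a, more than 2d - 4. -/
theorem dg_goodSet_le (D : IsDenseSplit G A B) {a : V} (ha : a ∈ goodSet G A B) :
    dg G a (goodSet G A B) ≤ 2 := by
  by_contra hcon
  obtain ⟨P, hP, hP3⟩ := exists_subset_card_eq (show 3 ≤ #{y ∈ goodSet G A B | G.Adj a y} from
    not_le.1 hcon)
  have hPg : ∀ p ∈ P, p ∈ A ∧ 1000 * nd G p B ≤ Fintype.card V ∧ G.Adj a p := by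
    intro p hp
    have := hP hp
    simp only [goodSet, mem_filter] at this
    exact ⟨this.1.1, this.1.2, this.2⟩
  simp only [goodSet, mem_filter] at ha
  have hPN : P ⊆ G.neighborFinset a := fun p hp => by simpa using (hPg p hp).2.2
  have h1 := D.sphere.eb_cross_le hPN
  have h2 := D.degree_le ha.1
  have h3 : G.neighborFinset a ∩ B ⊆ G.neighborFinset a \ P := by
    intro x hx
    rw [mem_inter] at hx
    exact mem_sdiff.2 ⟨hx.1, fun hxP => Finset.disjoint_left.1 D.disj (hPg x hxP).1 hx.2⟩
  have h4 : nb G P (G.neighborFinset a ∩ B) * 1000 ≤ 3 * Fintype.card V := by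
    rw [nb, sum_mul, ← hP3, ← smul_eq_mul (#P), ← sum_const]
    refine sum_le_sum fun p hp => ?_
    have := nd_mono (G := G) (inter_subset_right : G.neighborFinset a ∩ B ⊆ B) p
    have := (hPg p hp).2.1
    omega
  have h5 := eb_add_nb (G := G) P (G.neighborFinset a ∩ B)
  have h6 := eb_mono (G := G) (subset_refl P) h3
  rw [hP3, ← dg_eq_card_inter] at h5
  have h7 := dg_add_nd (G := G) a B
  have h8 := D.symm.balanced
  have h9 := D.large
  norm_num at h9
  omega

theorem eb_inner_le (D : IsDenseSplit G A B) : eb G A A ≤ 2 * #A + 200000000000000000 := by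
  have hg : goodSet G A B ⊆ A := filter_subset _ _
  have hd : Disjoint (goodSet G A B) (A \ goodSet G A B) := disjoint_sdiff
  have h1 := D.card_bad_le
  have h2 := D.eb_left_le (sdiff_subset : A \ goodSet G A B ⊆ A)
  have h3 : eb G A A = eb G (goodSet G A B) (goodSet G A B) +
      eb G (A \ goodSet G A B) (goodSet G A B) + eb G (A \ goodSet G A B) A := by
    rw [eb_comm (A \ goodSet G A B) (goodSet G A B), ← eb_union_right hd, union_sdiff_of_subset hg,
      ← eb_union_left hd, union_sdiff_of_subset hg]
  have h4 := eb_mono (G := G) (subset_refl (A \ goodSet G A B)) hg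
  have h5 : eb G (goodSet G A B) (goodSet G A B) ≤ 2 * #(goodSet G A B) := by
    rw [mul_comm, ← smul_eq_mul, ← sum_const]
    exact sum_le_sum fun x hx => D.dg_goodSet_le hx
  have h6 := card_le_card hg
  omega

/-- The edges are recounted with inner degrees averaging about two. With r vertices outside both
parts, 4 nb is at most (2 - 2r)n up to a small multiple of n. Hence r ≤ 1, with nb tiny for r = 1
and at most about n/2 for r = 0. -/
theorem master (D : IsDenseSplit G A B) :
    4 * (nb G A B : ℤ) + (Fintype.card V : ℤ) ^ 2 + 2 * Fintype.card V ≤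
      ((Fintype.card V : ℤ) - #(A ∪ B)ᶜ) ^ 2 + 4 * Fintype.card V +
      800000000000000000 + 4 * ∑ x ∈ (A ∪ B)ᶜ, G.degree x := by
  have h1 := D.two_mul_edges_le
  have h2 := D.eb_inner_le
  have h3 := D.symm.eb_inner_le
  have h5 := eb_add_nb (G := G) A B
  have h6 := D.card_add
  have h7 := D.dense
  set R := ∑ x ∈ (A ∪ B)ᶜ, G.degree x
  have h8 : (Fintype.card V : ℤ) - #(A ∪ B)ᶜ = #A + #B := by omega
  rw [h8]
  zify at h1 h2 h3 h5 h6 ⊢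
  nlinarith [sq_nonneg ((#A : ℤ) - #B)]

theorem card_rest_le_one (D : IsDenseSplit G A B) : #(A ∪ B)ᶜ ≤ 1 := by
  by_contra hcon
  have h1 := D.master
  have h2 := D.sum_rest_le'
  have h3 := D.card_rest
  have h4 := D.large
  norm_num at h4
  set R := ∑ x ∈ (A ∪ B)ᶜ, G.degree x
  zify at h2 h3 h4 hcon h1
  nlinarith

theorem nb_le_of_card_rest_eq_one (D : IsDenseSplit G A B) (h : #(A ∪ B)ᶜ = 1) :
    1000 * nb G A B ≤ Fintype.card V := by
  have h1 := D.master
  have h2 := D.sum_rest_le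
  have h4 := D.large
  norm_num at h4
  rw [h] at h1 h2
  set R := ∑ x ∈ (A ∪ B)ᶜ, G.degree x
  zify at h2 h4 h1 ⊢
  nlinarith

theorem nb_le_of_card_rest_eq_zero (D : IsDenseSplit G A B) (h : #(A ∪ B)ᶜ = 0) :
    1000 * nb G A B ≤ 501 * Fintype.card V := by
  have h1 := D.master
  have h2 := D.sum_rest_le
  have h4 := D.large
  norm_num at h4
  rw [h] at h1 h2
  set R := ∑ x ∈ (A ∪ B)ᶜ, G.degree x
  zify at h2 h4 h1 ⊢
  nlinarith

theorem mem_pureSet {a : V} (ha : a ∈ pureSet G A B) :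
    a ∈ A ∧ a ∈ goodSet G A B ∧ 1000 * nd G a B ≤ Fintype.card V ∧
      ∀ x, G.Adj a x → x ∈ B ∨ x ∈ goodSet G A B := by
  simp only [pureSet, goodSet, mem_filter] at *
  tauto

theorem pureSet_subset (G : SimpleGraph V) [DecidableRel G.Adj] (A B : Finset V) :
    pureSet G A B ⊆ A := (filter_subset _ _).trans (filter_subset _ _)

/-- A vertex that is not pure is bad, or adjacent to a bad vertex of its part, or adjacent to a
vertex outside both parts. -/
theorem card_not_pure_le (D : IsDenseSplit G A B) :
    #(A \ pureSet G A B) ≤ 100000000000000000 + ∑ x ∈ (A ∪ B)ᶜ, G.degree x := by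
  have hsub : A \ pureSet G A B ⊆ (A \ goodSet G A B) ∪
      ((A \ goodSet G A B).biUnion (fun x => G.neighborFinset x ∩ A) ∪
        (A ∪ B)ᶜ.biUnion (fun x => G.neighborFinset x)) := by
    intro a ha
    rw [mem_sdiff, pureSet, mem_filter, not_and_or] at ha
    obtain ⟨haA, ha | ha⟩ := ha
    · exact mem_union_left _ (mem_sdiff.2 ⟨haA, ha⟩)
    · push Not at ha
      obtain ⟨x, hax, hxB, hxg⟩ := ha
      refine mem_union_right _ ?_
      by_cases hxA : x ∈ A
      · refine mem_union_left _ (mem_biUnion.2 ⟨x, mem_sdiff.2 ⟨hxA, hxg⟩, ?_⟩)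
        simp [haA, hax.symm]
      · refine mem_union_right _ (mem_biUnion.2 ⟨x, by simp [hxA, hxB], ?_⟩)
        simp [hax.symm]
  have h1 := D.card_bad_le
  have h2 : #((A \ goodSet G A B).biUnion (fun x => G.neighborFinset x ∩ A)) ≤
      #(A \ goodSet G A B) * 12000000 := by
    refine card_biUnion_le_card_mul _ _ _ fun x hx => ?_
    rw [← dg_eq_card_inter]
    exact D.dg_left x (mem_sdiff.1 hx).1
  have h3 : #((A ∪ B)ᶜ.biUnion (fun x => G.neighborFinset x)) ≤ ∑ x ∈ (A ∪ B)ᶜ, G.degree x :=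
    card_biUnion_le
  have h4 := (card_le_card hsub).trans (card_union_le _ _)
  have h5 := card_union_le ((A \ goodSet G A B).biUnion (fun x => G.neighborFinset x ∩ A))
    ((A ∪ B)ᶜ.biUnion (fun x => G.neighborFinset x))
  omega

theorem card_not_pure_le' (D : IsDenseSplit G A B) :
    1000 * #(A \ pureSet G A B) ≤ Fintype.card V := by
  have h1 := D.card_not_pure_le
  have h2 := D.sum_rest_le'
  have h3 := D.large
  norm_num at h3
  omega

theorem dg_pure_le (D : IsDenseSplit G A B) {a : V} (ha : a ∈ pureSet G A B) : dg G a A ≤ 2 := by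
  obtain ⟨haA, hag, -, hx⟩ := mem_pureSet ha
  refine le_trans (card_le_card ?_) (D.dg_goodSet_le hag)
  intro x hx'
  rw [mem_filter] at hx' ⊢
  refine ⟨(hx x hx'.2).resolve_left fun hB => Finset.disjoint_left.1 D.disj hx'.1 hB, hx'.2⟩

theorem mem_union_of_pure_adj {a x : V} (ha : a ∈ pureSet G A B)
    (h : G.Adj a x) : x ∈ A ∨ x ∈ B := by
  obtain h1 | h1 := (mem_pureSet ha).2.2.2 x h
  · exact Or.inr h1
  · exact Or.inl (mem_filter.1 h1).1

/-- The link of ab has at least four vertices, all in `A` or `B`. At most two are neighbours of a in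
`A` and at most two are neighbours of b in `B`, so both pairs occur in full. -/
theorem pure_adj_pure (D : IsDenseSplit G A B) {a b : V} (ha : a ∈ pureSet G A B)
    (hb : b ∈ pureSet G B A) (hab : G.Adj a b) :
    dg G a A = 2 ∧ ∀ a' ∈ A, G.Adj a a' → G.Adj a' b := by
  have h1 := D.sphere.four_le a b hab
  have h2 := D.dg_pure_le ha
  have h3 := D.symm.dg_pure_le hb
  have h4 : G.neighborFinset a ∩ G.neighborFinset b ⊆
      {x ∈ A | G.Adj a x ∧ G.Adj x b} ∪ {x ∈ B | G.Adj b x} := by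
    intro x hx
    simp only [mem_inter, SimpleGraph.mem_neighborFinset] at hx
    have := mem_union_of_pure_adj ha hx.1
    simp only [mem_union, mem_filter]
    have := hx.2.symm
    tauto
  have h5 := (card_le_card h4).trans (card_union_le _ _)
  have h6 : ({x ∈ A | G.Adj a x ∧ G.Adj x b} : Finset V) ⊆ {x ∈ A | G.Adj a x} := by
    intro x; simp only [mem_filter]; tauto
  have h7 := card_le_card h6
  unfold dg at h2 h3 ⊢
  have h8 := eq_of_subset_of_card_le h6 (by omega)
  refine ⟨by omega, fun a' ha' haa => ?_⟩
  have : a' ∈ ({x ∈ A | G.Adj a x ∧ G.Adj x b} : Finset V) := by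
    rw [h8]; simp [ha', haa]
  simp only [mem_filter] at this
  exact this.2.2

theorem card_pure_neighbors (D : IsDenseSplit G A B) {a : V} (ha : a ∈ pureSet G A B) :
    400 * Fintype.card V ≤ 1000 * #{b ∈ pureSet G B A | G.Adj a b} := by
  have h1 := D.symm.balanced
  have h2 := D.symm.card_not_pure_le'
  have h3 := (mem_pureSet ha).2.2.1
  have h4 : B ⊆ {b ∈ pureSet G B A | G.Adj a b} ∪ ((B \ pureSet G B A) ∪
      {b ∈ B | ¬ G.Adj a b}) := by
    intro b hb
    simp only [mem_union, mem_filter, mem_sdiff]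
    tauto
  have h5 := (card_le_card h4).trans (card_union_le _ _)
  have h6 := card_union_le (B \ pureSet G B A) {b ∈ B | ¬ G.Adj a b}
  unfold nd at h3
  omega

theorem exists_pure_neighbor (D : IsDenseSplit G A B) {a : V} (ha : a ∈ pureSet G A B) :
    ∃ b ∈ pureSet G B A, G.Adj a b := by
  have h1 := D.card_pure_neighbors ha
  have h2 := D.large
  norm_num at h2
  obtain ⟨b, hb⟩ := card_pos.1 (show 0 < #{b ∈ pureSet G B A | G.Adj a b} by omega)
  rw [mem_filter] at hb
  exact ⟨b, hb⟩

theorem dg_pure (D : IsDenseSplit G A B) {a : V} (ha : a ∈ pureSet G A B) : dg G a A = 2 := by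
  obtain ⟨b, hb, hab⟩ := D.exists_pure_neighbor ha
  exact (D.pure_adj_pure ha hb hab).1

/-- Otherwise all pure neighbours of a in `B` would be common neighbours of the triangle a, x, y,
which has only two. -/
theorem not_adj_of_pure (D : IsDenseSplit G A B) {a x y : V} (ha : a ∈ pureSet G A B)
    (hx : x ∈ A) (hy : y ∈ A) (hax : G.Adj a x) (hay : G.Adj a y) : ¬ G.Adj x y := by
  intro hxy
  have h1 := D.card_pure_neighbors ha
  have h2 := D.large
  norm_num at h2
  have h3 := D.sphere.triangle a x y hax hay hxy
  have h4 : ({b ∈ pureSet G B A | G.Adj a b} : Finset V) ⊆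
      G.neighborFinset a ∩ G.neighborFinset x ∩ G.neighborFinset y := by
    intro b hb
    rw [mem_filter] at hb
    have := (D.pure_adj_pure ha hb.1 hb.2).2
    simp [hb.2, this x hx hax, this y hy hay]
  have := card_le_card h4
  omega

end IsDenseSplit

end Pure

/-! ### Typical vertices and the main theorem -/

section Typical

set_option linter.unusedSectionVars false

variable {V : Type*} [Fintype V] [DecidableEq V] {G : SimpleGraph V} [DecidableRel G.Adj]

/-- The pure vertices of `A` whose neighbours in `B` are adjacent to all their neighbours in `A`. -/
def typicalSet (G : SimpleGraph V) [DecidableRel G.Adj] (A B : Finset V) : Finset V :=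
  {a ∈ pureSet G A B | ∀ x ∈ A, G.Adj a x → ∀ b ∈ B, G.Adj a b → G.Adj x b}

/-- The pure vertices of `A` adjacent to `b` that have a neighbour in `A` not adjacent to `b`. -/
def switchSet (G : SimpleGraph V) [DecidableRel G.Adj] (A B : Finset V) (b : V) : Finset V :=
  {a ∈ pureSet G A B | G.Adj a b ∧ ∃ x ∈ A, G.Adj a x ∧ ¬ G.Adj x b}

namespace IsDenseSplit

variable {A B : Finset V}

/-- By `le_eb_inner`, the neighbours of b in `A` have inner degree sum at least 2 * #P up to a
constant. Pure vertices contribute at most two, switching ones at most one, and only the boundedly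
many impure ones can compensate. -/
theorem card_switchSet_le (D : IsDenseSplit G A B) (h0 : #(A ∪ B)ᶜ = 0) {b : V} (hb : b ∈ B) :
    #(switchSet G A B b) ≤ 2000000000000000000000000 := by
  have hAB : A ∪ B = univ := by rwa [card_eq_zero, compl_eq_empty_iff] at h0
  have hnp := D.card_not_pure_le
  rw [card_eq_zero.1 h0, sum_empty] at hnp
  set P := G.neighborFinset b ∩ A with hP
  have hPN : P ⊆ G.neighborFinset b := inter_subset_left
  have hQ : G.neighborFinset b \ P = G.neighborFinset b ∩ B :=
    sdiff_inter_of_subset_union D.disj (hAB ▸ subset_univ _)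
  have h1 := D.sphere.le_eb_inner hPN
  rw [hQ] at h1
  have hQc : #(G.neighborFinset b ∩ B) ≤ 12000000 := by
    rw [← dg_eq_card_inter]; exact D.dg_right b hb
  have hQQ : eb G (G.neighborFinset b ∩ B) (G.neighborFinset b ∩ B) ≤ 12000000 * 12000000 := by
    have := eb_add_nb (G := G) (G.neighborFinset b ∩ B) (G.neighborFinset b ∩ B)
    have := Nat.mul_le_mul hQc hQc
    omega
  have hPd : #P ≤ G.degree b := by
    rw [← SimpleGraph.card_neighborFinset_eq_degree]; exact card_le_card hPN
  have hsw : switchSet G A B b ⊆ P := by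
    intro a ha
    simp only [switchSet, mem_filter] at ha
    simp [hP, ha.2.1.symm, pureSet_subset G A B ha.1]
  have hpt : ∀ a ∈ P, dg G a P + (if a ∈ switchSet G A B b then 1 else 0) ≤
      2 + 12000000 * (if a ∈ A \ pureSet G A B then 1 else 0) := by
    intro a ha
    have haA : a ∈ A := (mem_inter.1 ha).2
    have hPA : dg G a P ≤ dg G a A := dg_mono inter_subset_right a
    by_cases hap : a ∈ pureSet G A B
    · have h2 := D.dg_pure_le hap
      rw [if_neg (fun h => (mem_sdiff.1 h).2 hap : a ∉ A \ pureSet G A B)]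
      split_ifs with hs
      · obtain ⟨-, -, a', ha', haa, hab⟩ := mem_filter.1 hs
        have : dg G a P < dg G a A := by
          refine card_lt_card ⟨filter_subset_filter _ inter_subset_right, fun hss => ?_⟩
          have h3 := hss (mem_filter.2 ⟨ha', haa⟩)
          simp only [hP, mem_filter, mem_inter, SimpleGraph.mem_neighborFinset] at h3
          exact hab h3.1.1.symm
        omega
      · omega
    · have h2 := D.dg_left a haA
      have h3 : a ∉ switchSet G A B b := fun h => hap (mem_filter.1 h).1
      rw [if_neg h3, if_pos (mem_sdiff.2 ⟨haA, hap⟩)]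
      omega
  have h2 := sum_le_sum hpt
  rw [sum_add_distrib, sum_add_distrib, ← mul_sum, sum_const, smul_eq_mul, sum_boole, sum_boole,
    filter_mem_eq_inter, filter_mem_eq_inter, inter_eq_right.2 hsw] at h2
  have h3 := card_le_card (inter_subset_right : P ∩ (A \ pureSet G A B) ⊆ _)
  simp only [Nat.cast_id] at h2
  unfold eb at h1
  unfold eb at hQQ
  omega

theorem card_not_typical_le (D : IsDenseSplit G A B) :
    100 * #(A \ typicalSet G A B) ≤ Fintype.card V := by
  have hlarge := D.large
  norm_num at hlarge
  have hnot : ∀ a ∈ A \ typicalSet G A B, a ∈ A \ pureSet G A B ∨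
      a ∈ pureSet G A B ∧ ∃ a' ∈ A, G.Adj a a' ∧ ∃ b ∈ B, G.Adj a b ∧ ¬ G.Adj a' b := by
    intro a ha
    simp only [typicalSet, mem_sdiff, mem_filter] at ha ⊢
    push Not at ha
    by_cases h : a ∈ pureSet G A B
    · exact Or.inr ⟨h, by simpa using ha.2 h⟩
    · exact Or.inl ⟨ha.1, h⟩
  rcases Nat.le_one_iff_eq_zero_or_eq_one.1 D.card_rest_le_one with h0 | h1
  -- By `pure_adj_pure` only an impure b can spoil a pure vertex; there are boundedly many, each
  -- with a bounded switch set.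
  · have hsub : A \ typicalSet G A B ⊆ (A \ pureSet G A B) ∪
        (B \ pureSet G B A).biUnion (switchSet G A B) := by
      intro a ha
      obtain h | ⟨h, a', ha', haa, b, hb, hab, hab'⟩ := hnot a ha
      · exact mem_union_left _ h
      · refine mem_union_right _ (mem_biUnion.2 ⟨b, mem_sdiff.2 ⟨hb, fun hbp => ?_⟩, ?_⟩)
        · exact hab' ((D.pure_adj_pure h hbp hab).2 a' ha' haa)
        · exact mem_filter.2 ⟨h, hab, a', ha', haa, hab'⟩
    have e1 := (card_le_card hsub).trans (card_union_le _ _)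
    have e2 : #((B \ pureSet G B A).biUnion (switchSet G A B)) ≤
        #(B \ pureSet G B A) * 2000000000000000000000000 :=
      card_biUnion_le_card_mul _ _ _ fun b hb => D.card_switchSet_le h0 (mem_sdiff.1 hb).1
    have e3 := D.card_not_pure_le
    have e4 := D.symm.card_not_pure_le
    rw [union_comm, card_eq_zero.1 h0, sum_empty] at e4
    rw [card_eq_zero.1 h0, sum_empty] at e3
    omega
  -- Now at most n/1000 pairs are missing. A spoiled pure vertex is next to a good vertex with a
  -- missing pair, and each of those has at most two good neighbours.
  · set M := ({a' ∈ goodSet G A B | 0 < nd G a' B} : Finset V) with hM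
    have hMA : M ⊆ A := (filter_subset _ _).trans (filter_subset _ _)
    have hsub : A \ typicalSet G A B ⊆ (A \ pureSet G A B) ∪
        M.biUnion (fun x => G.neighborFinset x ∩ goodSet G A B) := by
      intro a ha
      obtain h | ⟨h, a', ha', haa, b, hb, hab, hab'⟩ := hnot a ha
      · exact mem_union_left _ h
      · refine mem_union_right _ (mem_biUnion.2 ⟨a', mem_filter.2 ⟨?_, ?_⟩, ?_⟩)
        · exact ((mem_pureSet h).2.2.2 a' haa).resolve_left
            fun hB => Finset.disjoint_left.1 D.disj ha' hB
        · exact card_pos.2 ⟨b, mem_filter.2 ⟨hb, hab'⟩⟩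
        · exact mem_inter.2 ⟨by simpa using haa.symm, (mem_pureSet h).2.1⟩
    have e1 := (card_le_card hsub).trans (card_union_le _ _)
    have e2 : #(M.biUnion (fun x => G.neighborFinset x ∩ goodSet G A B)) ≤ #M * 2 := by
      refine card_biUnion_le_card_mul _ _ _ fun x hx => ?_
      rw [← dg_eq_card_inter]
      exact D.dg_goodSet_le (mem_filter.1 hx).1
    have e3 := D.card_not_pure_le'
    have e4 : #M * 1 ≤ 1 * nb G M B := mul_card_le fun x hx => by
      rw [one_mul]; exact (mem_filter.1 hx).2
    have e5 := nb_mono (G := G) hMA (subset_refl B)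
    have e6 := D.nb_le_of_card_rest_eq_one h1
    omega

theorem typicalSet_subset (G : SimpleGraph V) [DecidableRel G.Adj] (A B : Finset V) :
    typicalSet G A B ⊆ A := (filter_subset _ _).trans (pureSet_subset G A B)

theorem card_typical (D : IsDenseSplit G A B) :
    489 * Fintype.card V ≤ 1000 * #(typicalSet G A B) := by
  have h1 := D.card_not_typical_le
  have h2 := D.balanced
  have h3 := card_sdiff_add_card_eq_card (typicalSet_subset G A B)
  omega

theorem exists_typical_nd_le (D : IsDenseSplit G A B) {k : ℕ}
    (h : 1000 * nb G A B < (k + 1) * (489 * Fintype.card V)) :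
    ∃ a ∈ typicalSet G A B, nd G a B ≤ k := by
  by_contra! hcon
  have h1 : #(typicalSet G A B) * (k + 1) ≤ 1 * nb G (typicalSet G A B) B :=
    mul_card_le fun x hx => by rw [one_mul]; exact hcon x hx
  have h2 := nb_mono (G := G) (typicalSet_subset G A B) (subset_refl B)
  have h3 := Nat.mul_le_mul_left (k + 1) D.card_typical
  nlinarith

/-- If the parts cover everything, some typical vertex of one part has no missing neighbour. -/
theorem exists_typical_full (D : IsDenseSplit G A B) (h0 : #(A ∪ B)ᶜ = 0)
    (hB : ∀ b ∈ typicalSet G B A, 0 < nd G b A) : ∃ a ∈ typicalSet G A B, nd G a B = 0 := by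
  by_contra! hcon
  have hlarge := D.large
  norm_num at hlarge
  have hnb := D.nb_le_of_card_rest_eq_zero h0
  have hnp := D.symm.card_not_pure_le
  rw [union_comm, card_eq_zero.1 h0, sum_empty] at hnp
  -- A vertex of B outside `M` is pure, and so are all its neighbours in B.
  set M := (B \ pureSet G B A) ∪
    (B \ pureSet G B A).biUnion (fun x => G.neighborFinset x ∩ B) with hM
  have hMB : M ⊆ B := by
    refine union_subset sdiff_subset (biUnion_subset.2 fun x _ => inter_subset_right)
  have hMc : #M ≤ 100000000000000000 * 12000001 := by
    have e1 := card_union_le (B \ pureSet G B A)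
      ((B \ pureSet G B A).biUnion (fun x => G.neighborFinset x ∩ B))
    have e2 : #((B \ pureSet G B A).biUnion (fun x => G.neighborFinset x ∩ B)) ≤
        #(B \ pureSet G B A) * 12000000 := by
      refine card_biUnion_le_card_mul _ _ _ fun x hx => ?_
      rw [← dg_eq_card_inter]
      exact D.dg_right x (mem_sdiff.1 hx).1
    rw [hM]
    omega
  have hAt := D.card_typical
  have hBt := D.symm.card_typical
  -- few typical vertices miss more than one vertex
  set T2 := ({a ∈ typicalSet G A B | 2 ≤ nd G a B} : Finset V) with hT2
  have c1 : #(typicalSet G A B) + #T2 ≤ nb G A B := by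
    refine le_trans ?_ (nb_mono (typicalSet_subset G A B) (subset_refl B))
    rw [hT2, card_filter, card_eq_sum_ones, ← sum_add_distrib]
    refine sum_le_sum fun a ha => ?_
    have := hcon a ha
    split_ifs <;> omega
  -- few typical vertices miss a vertex of `M`
  set T3 := ({a ∈ typicalSet G A B | 0 < nd G a M} : Finset V) with hT3
  have c2 : #T3 + #(typicalSet G B A \ M) ≤ nb G A B := by
    have e1 : #T3 * 1 ≤ 1 * nb G T3 M := mul_card_le fun x hx => by
      rw [one_mul]; exact (mem_filter.1 hx).2
    have e2 : #(typicalSet G B A \ M) * 1 ≤ 1 * nb G (typicalSet G B A \ M) A :=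
      mul_card_le fun x hx => by
        rw [one_mul]; exact hB x (mem_sdiff.1 hx).1
    have e3 : nb G T3 M ≤ nb G A M :=
      nb_mono ((filter_subset _ _).trans (typicalSet_subset G A B)) (subset_refl M)
    have e4 := nb_mono (G := G) (sdiff_subset_sdiff (typicalSet_subset G B A) (subset_refl M))
      (subset_refl A)
    have e5 : nb G A B = nb G A M + nb G (B \ M) A := by
      rw [nb_comm (B \ M) A, ← nb_union_right disjoint_sdiff, union_sdiff_of_subset hMB]
    omega
  have c3 := le_card_sdiff M (typicalSet G B A)
  -- At least 0.489n typical vertices on each side face at most 0.501n missing pairs, so `T2` and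
  -- `T3` have about 0.012n elements each. Some a thus misses a single b, and b lies outside `M`.
  have hex : ∃ a ∈ typicalSet G A B, a ∉ T2 ∪ T3 := by
    by_contra! h
    have := (card_le_card h).trans (card_union_le _ _)
    omega
  obtain ⟨a, ha, haT⟩ := hex
  have hap : a ∈ pureSet G A B := (mem_filter.1 ha).1
  have ha1 : nd G a B = 1 ∧ nd G a M = 0 := by
    simp only [hT2, hT3, mem_union, mem_filter, ha, true_and, not_or] at haT
    have := hcon a ha
    omega
  obtain ⟨b, hb⟩ := card_eq_one.1 ha1.1
  have hbB : b ∈ B ∧ ¬ G.Adj a b := by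
    have : b ∈ ({y ∈ B | ¬ G.Adj a y} : Finset V) := by rw [hb]; simp
    simpa using this
  have hbM : b ∉ M := by
    intro h
    have h2 := card_eq_zero.1 ha1.2
    rw [filter_eq_empty_iff] at h2
    exact h2 h hbB.2
  have hbp : b ∈ pureSet G B A := by
    by_contra h
    exact hbM (mem_union_left _ (mem_sdiff.2 ⟨hbB.1, h⟩))
  have h2 := D.symm.dg_pure hbp
  obtain ⟨b', hb'⟩ := card_pos.1 (show 0 < #{y ∈ B | G.Adj b y} by unfold dg at h2; omega)
  rw [mem_filter] at hb'
  have hbp' : b' ∈ pureSet G B A := by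
    by_contra h
    refine hbM (mem_union_right _ (mem_biUnion.2 ⟨b', mem_sdiff.2 ⟨hb'.1, h⟩, ?_⟩))
    simp [hbB.1, hb'.2.symm]
  have hab' : G.Adj a b' := by
    by_contra h
    have : b' ∈ ({y ∈ B | ¬ G.Adj a y} : Finset V) := by simp [hb'.1, h]
    rw [hb, mem_singleton] at this
    exact hb'.2.ne this.symm
  -- The pure vertices b' and a are adjacent, so a is also adjacent to b, the neighbour of b' in B.
  exact hbB.2 ((D.symm.pure_adj_pure hbp' hap hab'.symm).2 b hbB.1 hb'.2.symm).symm

/-- The sum bounds the number of vertices outside N(a) ∩ B and N(b) ∩ A. For r = 0, averaging gives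
at most one missing neighbour on one side because 501 < 2 · 489, and `exists_typical_full` provides
zero on the other if needed. -/
theorem exists_typical_pair (D : IsDenseSplit G A B) :
    ∃ a ∈ typicalSet G A B, ∃ b ∈ typicalSet G B A,
      nd G a B + nd G b A + #(A ∪ B)ᶜ ≤ 1 := by
  have hlarge := D.large
  norm_num at hlarge
  rcases Nat.le_one_iff_eq_zero_or_eq_one.1 D.card_rest_le_one with h0 | h1
  · have hnb := D.nb_le_of_card_rest_eq_zero h0
    by_cases hB : ∃ b ∈ typicalSet G B A, nd G b A = 0
    · obtain ⟨b, hb, hb0⟩ := hB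
      obtain ⟨a, ha, ha1⟩ := D.exists_typical_nd_le (k := 1) (by omega)
      exact ⟨a, ha, b, hb, by omega⟩
    · push Not at hB
      obtain ⟨a, ha, ha0⟩ := D.exists_typical_full h0 fun b hb => Nat.pos_of_ne_zero (hB b hb)
      obtain ⟨b, hb, hb1⟩ := D.symm.exists_typical_nd_le (k := 1) (by rw [nb_comm]; omega)
      exact ⟨a, ha, b, hb, by omega⟩
  · have hnb := D.nb_le_of_card_rest_eq_one h1
    obtain ⟨a, ha, ha1⟩ := D.exists_typical_nd_le (k := 0) (by omega)
    obtain ⟨b, hb, hb1⟩ := D.symm.exists_typical_nd_le (k := 0) (by rw [nb_comm]; omega)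
    exact ⟨a, ha, b, hb, by omega⟩

/-- The neighbours of a typical vertex in the other part form the link of an edge. -/
theorem exists_edge_link (D : IsDenseSplit G A B) {a : V} (ha : a ∈ typicalSet G A B) :
    ∃ a', G.Adj a a' ∧ G.neighborFinset a ∩ G.neighborFinset a' = G.neighborFinset a ∩ B := by
  obtain ⟨hap, hat⟩ := mem_filter.1 ha
  have h2 := D.dg_pure hap
  obtain ⟨a', ha'⟩ := card_pos.1 (show 0 < #{y ∈ A | G.Adj a y} by unfold dg at h2; omega)
  rw [mem_filter] at ha'
  refine ⟨a', ha'.2, ?_⟩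
  ext x
  simp only [mem_inter, SimpleGraph.mem_neighborFinset]
  refine and_congr_right fun hx => ⟨fun hx' => ?_, fun hxB => hat a' ha'.1 ha'.2 x hxB hx⟩
  refine (mem_union_of_pure_adj hap hx).resolve_left fun hxA => ?_
  exact D.not_adj_of_pure hap ha'.1 hxA ha'.2 hx hx'

/-- If x is in `A`, its non-adjacency to b uses up the whole budget, so b lies in N(a) ∩ B without
being adjacent to x. Any other x has too few neighbours in `B` to contain this large set. -/
theorem not_subset_neighborFinset (D : IsDenseSplit G A B) {a b x : V}
    (ha : a ∈ typicalSet G A B) (hb : b ∈ typicalSet G B A)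
    (hab : nd G a B + nd G b A + #(A ∪ B)ᶜ ≤ 1) (hxb : x ∉ G.neighborFinset b ∩ A) :
    ¬ G.neighborFinset a ∩ B ⊆ G.neighborFinset x := by
  intro hsub
  have hlarge := D.large
  norm_num at hlarge
  have h1 := D.symm.balanced
  have h2 := (mem_pureSet (mem_filter.1 ha).1).2.2.1
  have h3 := dg_add_nd (G := G) a B
  have hbB : b ∈ B := typicalSet_subset G B A hb
  by_cases hxA : x ∈ A
  · have hbx : ¬ G.Adj b x := fun h => hxb (by simp [h, hxA])
    have h4 : 0 < nd G b A := card_pos.2 ⟨x, mem_filter.2 ⟨hxA, hbx⟩⟩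
    have h5 : nd G a B = 0 := by omega
    have h6 : G.Adj a b := by
      by_contra h
      have : 0 < nd G a B := card_pos.2 ⟨b, mem_filter.2 ⟨hbB, h⟩⟩
      omega
    have h7 : b ∈ G.neighborFinset x := hsub (by simp [h6, hbB])
    rw [SimpleGraph.mem_neighborFinset] at h7
    exact hbx h7.symm
  · have h4 : dg G a B ≤ dg G x B := by
      rw [dg_eq_card_inter, dg_eq_card_inter]
      exact card_le_card fun y hy => mem_inter.2 ⟨hsub hy, (mem_inter.1 hy).2⟩
    by_cases hxB : x ∈ B
    · have := D.dg_right x hxB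
      omega
    · have h5 := D.degree_rest x (by simp [hxA, hxB])
      have := dg_le_degree (G := G) x B
      omega

end IsDenseSplit

theorem IsFascinating.isJoinOfTwoCycles_of_dense (hG : IsFascinating G)
    (hn : 10 ^ 60 ≤ Fintype.card V)
    (hm : (Fintype.card V : ℤ) ^ 2 + 2 * Fintype.card V + 17 < 4 * #G.edgeFinset) :
    IsJoinOfTwoCycles G := by
  obtain ⟨A, B, hAB⟩ := hG.isFlagSphereLike.exists_isSplit hm hn
  have D : IsDenseSplit G A B := ⟨hAB, hG.isFlagSphereLike, hm, hn⟩
  obtain ⟨a, ha, b, hb, hab⟩ := D.exists_typical_pair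
  obtain ⟨a', haa, hY⟩ := D.exists_edge_link ha
  obtain ⟨b', hbb, hZ⟩ := D.symm.exists_edge_link hb
  refine hG.isJoinOfTwoCycles_of_cover haa hbb ?_ ?_ ?_ hm
  · rw [hY, hZ]
    exact D.disj.mono inter_subset_right inter_subset_right
  · rw [hY, hZ]
    have hsub : ((G.neighborFinset b ∩ A) ∪ (G.neighborFinset a ∩ B))ᶜ ⊆
        {y ∈ B | ¬ G.Adj a y} ∪ ({y ∈ A | ¬ G.Adj b y} ∪ (A ∪ B)ᶜ) := by
      intro x hx
      simp only [mem_compl, mem_union, mem_inter, SimpleGraph.mem_neighborFinset,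
        mem_filter] at hx ⊢
      tauto
    have h1 := (card_le_card hsub).trans (card_union_le _ _)
    have h2 := card_union_le ({y ∈ A | ¬ G.Adj b y} : Finset V) (A ∪ B)ᶜ
    unfold nd at hab
    omega
  · rw [hY, hZ]
    intro x hx
    rw [mem_union, not_or] at hx
    exact ⟨D.symm.not_subset_neighborFinset hb ha (by rw [union_comm]; omega) hx.2,
      D.not_subset_neighborFinset ha hb hab hx.1⟩

end Typical

end FlagGraph

theorem theorem1p5 :
    ∃ n₀ : ℕ, ∀ (V : Type*) [Fintype V] [DecidableEq V] (G : SimpleGraph V) [DecidableRel G.Adj],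
      FlagGraph.IsFascinating G →
      n₀ ≤ Fintype.card V →
      (G.edgeFinset.card : ℝ) > ((Fintype.card V : ℝ) ^ 2 + 2 * (Fintype.card V : ℝ) + 17) / 4 →
      FlagGraph.IsJoinOfTwoCycles G := by
  -- Any bound above the accumulated constants works; those in `card_not_typical_le` alone need
  -- about 10⁴³.
  refine ⟨10 ^ 60, fun V _ _ G _ hG hn hm => hG.isJoinOfTwoCycles_of_dense hn ?_⟩
  have h : (Fintype.card V : ℝ) ^ 2 + 2 * Fintype.card V + 17 < 4 * #G.edgeFinset := by linarith
  exact_mod_cast h
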